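/- A weighted graph $H$ on a connected graph $G$ assigns a positive real weight to each edge of $G$. The cost of a path is the sum of the weights of its edges, $d_H(u,v)$ is the infimum of the costs of the paths from $u$ to $v$, and a geodesic is a path attaining this infimum. For vertices $u,v$ and real $r\ge 0$, the geodesic slice $S_H(u,v,r)$ is the set of vertices $w$ that lie on some geodesic between $u$ and $v$ and satisfy $d_H(u,w)=r$. We say that $H$ has bounded geodesic slices if there is a constant $C$ with $|S_H(u,v,r)|\le C$ for all $u,v$ and all $r\ge 0$. Let $\mathbb{Z}^2$ also denote the square lattice, in which two points of $\mathbb{Z}^2$ are adjacent when their $\ell_1$-distance is $1$. **Proposition.** There exists a weighted graph on $\mathbb{Z}^2$ using finitely many positive integer weights with bounded geodesic slices. Concretely, let $p\ge 3$ be an odd integer and let $a<b$ be positive integers. Call an edge of $\mathbb{Z}^2$ slow if it is of the form $$\left(p^n x+\tfrac{p^n-1}{2},\,p^n y\right)\left(p^n x+\tfrac{p^n+1}{2},\,p^n y\right)\quad\text{with } n\in\mathbb{Z}_{\ge 0},\ x,y\in\mathbb{Z},\ p\nmid y,$$ or $$\left(p^n x,\,p^n y+\tfrac{p^n-1}{2}\right)\left(p^n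 x,\,p^n y+\tfrac{p^n+1}{2}\right)\quad\text{with } n\in\mathbb{Z}_{\ge 0},\ x,y\in\mathbb{Z},\ p\nmid x,$$ and let $H_{a,b}$ be the weighted graph on $\mathbb{Z}^2$ that gives weight $b$ to slow edges and weight $a$ to all other edges. Then for all $u,v\in\mathbb{Z}^2$ and all real $r\ge 0$, $$\left|S_{H_{a,b}}(u,v,r)\right|\le 160\,\frac{b^2p^2}{a^2}+64\,p\left(p+\frac{3b}{a}\right)\log_p\!\left(\frac{18bp^2}{a}\right).$$ -/

import Mathlib

/-- A weighted graph on `G`: a positive real weight on every edge of `G`. -/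
structure WeightedGraph {V : Type*} (G : SimpleGraph V) where
  /-- The weight of an edge. -/
  weight : G.edgeSet → ℝ
  weight_pos : ∀ e, 0 < weight e

namespace WeightedGraph

variable {V : Type*} {G : SimpleGraph V}

/-- The cost of a walk: the sum of the weights of its edges, with multiplicity. -/
def cost (H : WeightedGraph G) : {u v : V} → G.Walk u v → ℝ
  | _, _, .nil => 0
  | _, _, .cons h q => H.weight ⟨s(_, _), G.mem_edgeSet.mpr h⟩ + H.cost q

/-- The weighted distance: the infimum of the costs of the walks between two vertices. (The costs
are bounded below by `0`, and the infimum is over a nonempty family when `G` is connected.) -/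
noncomputable def dist (H : WeightedGraph G) (u v : V) : ℝ :=
  ⨅ γ : G.Walk u v, H.cost γ

/-- A weighted geodesic: a walk whose cost is the weighted distance between its endpoints.
(As weights are positive, such a walk never repeats a vertex.) -/
def IsGeodesic (H : WeightedGraph G) {u v : V} (γ : G.Walk u v) : Prop :=
  H.cost γ = H.dist u v

/-- The geodesic slice `S(u, v, r)`: the vertices that lie on a weighted geodesic between `u` and
`v` and have weighted distance `r` to `u`. -/
def slice (H : WeightedGraph G) (u v : V) (r : ℝ) : Set V :=
  {w | (∃ γ : G.Walk u v, H.IsGeodesic γ ∧ w ∈ γ.support) ∧ H.dist u w = r}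

/-- All geodesic slices are finite, with at most `C` elements. -/
def SlicesBoundedBy (H : WeightedGraph G) (C : ℝ) : Prop :=
  ∀ (u v : V) (r : ℝ), 0 ≤ r → (H.slice u v r).Finite ∧ ((H.slice u v r).ncard : ℝ) ≤ C

/-- Bounded geodesic slices: the sizes of all geodesic slices have a common bound. -/
def HasBoundedSlices (H : WeightedGraph G) : Prop :=
  ∃ C : ℝ, H.SlicesBoundedBy C

end WeightedGraph

/-- The square lattice: two points of `ℤ × ℤ` are adjacent when their `ℓ¹`-distance is `1`. -/
def squareLattice : SimpleGraph (ℤ × ℤ) where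
  Adj u v := |u.1 - v.1| + |u.2 - v.2| = 1
  symm := ⟨fun u v h => by rwa [abs_sub_comm v.1, abs_sub_comm v.2]⟩
  loopless := ⟨fun u h => by simp at h⟩

/-- The slow edges with parameter `p` (odd, so that the divisions by `2` are exact). A horizontal
slow edge is the middle edge of the straight segment from `pⁿ(x, y)` to `pⁿ(x + 1, y)` for some
`n ≥ 0` and `x, y` with `p ∤ y`; a vertical slow edge is the middle edge of the straight segment
from `pⁿ(x, y)` to `pⁿ(x, y + 1)` for some `n ≥ 0` and `x, y` with `p ∤ x`. -/
def IsSlow (p : ℕ) (e : Sym2 (ℤ × ℤ)) : Prop :=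
  ∃ (n : ℕ) (x y : ℤ),
    (¬ (p : ℤ) ∣ y ∧
      e = s(((p : ℤ) ^ n * x + ((p : ℤ) ^ n - 1) / 2, (p : ℤ) ^ n * y),
            ((p : ℤ) ^ n * x + ((p : ℤ) ^ n + 1) / 2, (p : ℤ) ^ n * y))) ∨
    (¬ (p : ℤ) ∣ x ∧
      e = s(((p : ℤ) ^ n * x, (p : ℤ) ^ n * y + ((p : ℤ) ^ n - 1) / 2),
            ((p : ℤ) ^ n * x, (p : ℤ) ^ n * y + ((p : ℤ) ^ n + 1) / 2)))

open Classical in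
/-- The weighted graph `H_{a,b}` on the square lattice: weight `b` on slow edges, weight `a` on all
other edges. -/
noncomputable def slowFastGraph (p a b : ℕ) (ha : 0 < a) (hb : 0 < b) :
    WeightedGraph squareLattice where
  weight e := if IsSlow p e then (b : ℝ) else (a : ℝ)
  weight_pos e := by
    split_ifs
    · exact_mod_cast hb
    · exact_mod_cast ha

/-! ### Costs, distances and walks in weighted graphs. -/

namespace WeightedGraph

variable {V : Type*} {G : SimpleGraph V}

/-! Call a row or column whose coordinate is divisible by `p ^ n` a line of level `n`. On a line of
exact level `n` one edge in `p ^ n` is slow, so lines of high level are highways. The potential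
`pot` of level `n` is the cost along such a line: lines of level `n` or higher cost at most this
much, lines of exact level at most `n` cost at least this much. Inside an open cell cut out by lines
of level `m + 1`, the sum of the two potentials of level `m` is therefore a lower bound for costs
(`cell_lipschitz`).

Take a vertex of a geodesic, far from both ends, and the smallest open cell around it. The geodesic
cannot enter and leave this cell through the same side or through adjacent sides, since following
the boundary is strictly cheaper. If it joins opposite sides, it never leaves the strip containing
them: the boundary highway would save `p - 1` slow edges and cost at most one
(`dist_lt_of_crossing`, `inCell_or_inStrip`). Hence, for a vertex far from the ends at scale `p ^
n`, either the geodesic is confined to a strip of level `n`, or the vertex lies on the grid of level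
`n` and is strictly farther from `u` than one side of its grid segment (`stripped_or_good`). In the
latter case a segment carries at most two vertices at a given distance.

For the count, reversal allows `2 * r ≤ dist u v`; choose `k` with `r` between `2 b p ^ k` and `2 b
p ^ (k + 1)` (for small `r`, level `0` suffices). Vertices good at level `k` lie in boundedly many
cells. Any other vertex is good at some level `m < k` on a geodesic confined to a strip of level `m
+ 1`. For fixed `m` there are boundedly many of these, because at distance `r` they all have nearly
the same position along the strip (`spread_le`). Only logarithmically many `m` occur: confinement to
a low strip bounds the excess cost over `a` times the horizontal displacement, which leaves no room
for the vertical detours made by geodesics at much higher levels (`level_le`). -/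

theorem cost_nil (H : WeightedGraph G) (u : V) : H.cost (.nil : G.Walk u u) = 0 := rfl

theorem cost_cons (H : WeightedGraph G) {u v w : V} (h : G.Adj u v) (q : G.Walk v w) :
    H.cost (.cons h q) = H.weight ⟨s(u, v), G.mem_edgeSet.mpr h⟩ + H.cost q := rfl

theorem cost_append (H : WeightedGraph G) {u v w : V} (p : G.Walk u v) (q : G.Walk v w) :
    H.cost (p.append q) = H.cost p + H.cost q := by
  induction p with
  | nil => simp [cost_nil]
  | cons h p ih => simp only [SimpleGraph.Walk.cons_append, cost_cons, ih]; ring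

theorem cost_reverse (H : WeightedGraph G) {u v : V} (p : G.Walk u v) :
    H.cost p.reverse = H.cost p := by
  induction p with
  | nil => simp
  | cons h p ih =>
    rename_i x y z
    have he : (⟨s(y, x), G.mem_edgeSet.mpr h.symm⟩ : G.edgeSet) =
        ⟨s(x, y), G.mem_edgeSet.mpr h⟩ := Subtype.ext Sym2.eq_swap
    simp only [SimpleGraph.Walk.reverse_cons, cost_append, cost_cons, cost_nil, ih, he]
    ring

theorem cost_nonneg (H : WeightedGraph G) {u v : V} (p : G.Walk u v) : 0 ≤ H.cost p := by
  induction p with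
  | nil => simp [cost_nil]
  | cons h p ih =>
    rw [cost_cons]
    exact add_nonneg (H.weight_pos _).le ih

theorem dist_le_cost (H : WeightedGraph G) {u v : V} (p : G.Walk u v) : H.dist u v ≤ H.cost p :=
  ciInf_le ⟨0, by rintro _ ⟨q, rfl⟩; exact H.cost_nonneg q⟩ p

theorem le_dist (H : WeightedGraph G) (hG : G.Preconnected) {u v : V} {x : ℝ}
    (h : ∀ p : G.Walk u v, x ≤ H.cost p) : x ≤ H.dist u v :=
  haveI : Nonempty (G.Walk u v) := hG u v
  le_ciInf h

theorem dist_comm (H : WeightedGraph G) (hG : G.Preconnected) (u v : V) :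
    H.dist u v = H.dist v u := by
  apply le_antisymm <;> refine H.le_dist hG fun p => ?_ <;>
    rw [← H.cost_reverse] <;> exact H.dist_le_cost _

theorem dist_triangle (H : WeightedGraph G) (hG : G.Preconnected) (u v w : V) :
    H.dist u w ≤ H.dist u v + H.dist v w := by
  have h1 : ∀ p : G.Walk u v, H.dist u w ≤ H.cost p + H.dist v w := fun p => by
    have : H.dist u w - H.cost p ≤ H.dist v w := H.le_dist hG fun q => by
      have := H.dist_le_cost (p.append q)
      rw [cost_append] at this
      linarith
    linarith
  have : H.dist u w - H.dist v w ≤ H.dist u v := H.le_dist hG fun p => by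
    have := h1 p
    linarith
  linarith

/-- A walk starting in `P` stays in `P`, or has a first vertex outside `P`; the part up to that
vertex costs at least as much as any `ρ` that edges leaving vertices of `P` dominate. -/
theorem stays_or_exits (H : WeightedGraph G) (P : V → Prop) (ρ : V → V → ℝ)
    (hρ0 : ∀ t, ρ t t ≤ 0)
    (hρ : ∀ x y (h : G.Adj x y), P x → ∀ t,
      ρ x t ≤ H.weight ⟨s(x, y), G.mem_edgeSet.mpr h⟩ + ρ y t)
    {w v : V} (γ : G.Walk w v) (hw : P w) :
    (∀ z ∈ γ.support, P z) ∨
      ∃ (z t : V) (h : G.Adj z t) (p₀ : G.Walk w z) (p₂ : G.Walk t v),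
        γ = p₀.append (.cons h p₂) ∧ (∀ x ∈ p₀.support, P x) ∧ ¬ P t ∧
        ρ w t ≤ H.cost p₀ + H.weight ⟨s(z, t), G.mem_edgeSet.mpr h⟩ := by
  induction γ with
  | nil => exact .inl (by simpa using hw)
  | cons h γ ih =>
    rename_i x y v
    by_cases hy : P y
    · rcases ih hy with ih | ⟨z, t, h', p₀, p₂, rfl, h1, h2, h3⟩
      · left
        simpa using ⟨hw, ih⟩
      · refine .inr ⟨z, t, h', .cons h p₀, p₂, rfl, by simpa using ⟨hw, h1⟩, h2, ?_⟩
        have := hρ x y h hw t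
        rw [cost_cons]
        linarith
    · refine .inr ⟨x, y, h, .nil, γ, rfl, by simpa using hw, hy, ?_⟩
      have h1 := hρ x y h hw y
      have h2 := hρ0 y
      rw [cost_nil]
      linarith

/-- A walk inside `P` costs at least as much as any `ρ` that edges leaving `P` dominate. -/
theorem le_cost_of_forall_mem (H : WeightedGraph G) (P : V → Prop) (ρ : V → V → ℝ)
    (hρ0 : ∀ t, ρ t t ≤ 0)
    (hρ : ∀ x y (h : G.Adj x y), P x → ∀ t,
      ρ x t ≤ H.weight ⟨s(x, y), G.mem_edgeSet.mpr h⟩ + ρ y t)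
    {w v : V} (γ : G.Walk w v) (hγ : ∀ z ∈ γ.support, P z) : ρ w v ≤ H.cost γ := by
  induction γ with
  | nil => simpa [cost_nil] using hρ0 _
  | cons h γ ih =>
    rename_i x y v
    simp only [SimpleGraph.Walk.support_cons, List.mem_cons, forall_eq_or_imp] at hγ
    have h1 := hρ x y h hγ.1 v
    have h2 := ih hγ.2
    rw [cost_cons]
    linarith

theorem cost_split (H : WeightedGraph G) {u v w : V} (γ : G.Walk u v) (hw : w ∈ γ.support) :
    ∃ (γ₁ : G.Walk u w) (γ₂ : G.Walk w v), γ = γ₁.append γ₂ ∧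
      H.cost γ = H.cost γ₁ + H.cost γ₂ := by
  classical
  refine ⟨γ.takeUntil w hw, γ.dropUntil w hw, (γ.take_spec hw).symm, ?_⟩
  rw [← cost_append, γ.take_spec hw]

end WeightedGraph

/-- The discrete intermediate value theorem along a walk. -/
theorem SimpleGraph.Walk.exists_mem_support_eq {V : Type*} {G : SimpleGraph V} (f : V → ℤ)
    (hf : ∀ x y, G.Adj x y → |f x - f y| ≤ 1) {u v : V} (γ : G.Walk u v) (c : ℤ)
    (hc : f u ≤ c ∧ c ≤ f v ∨ f v ≤ c ∧ c ≤ f u) : ∃ z ∈ γ.support, f z = c := by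
  induction γ with
  | @nil u => exact ⟨u, by simp, by omega⟩
  | cons h γ ih =>
    rename_i x y v
    by_cases hx : f x = c
    · exact ⟨x, by simp, hx⟩
    · have := abs_le.1 (hf x y h)
      obtain ⟨z, hz, hzc⟩ := ih (by omega)
      exact ⟨z, by simp [hz], hzc⟩

/-! ### Potentials along lines of a given level. -/

/-- The number of the multiple of `p ^ n` closest to `x`, for odd `p`. -/
def nearestIdx (p n : ℕ) (x : ℤ) : ℤ := (2 * x + (p : ℤ) ^ n) / (2 * (p : ℤ) ^ n)

/-- The potential along a line of level exactly `n`: it grows by `b` across the middle edges of the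
segments of length `p ^ n`, and by `a` across the other edges. -/
noncomputable def pot (p a b n : ℕ) (x : ℤ) : ℝ := a * x + ((b : ℝ) - a) * nearestIdx p n x

theorem nearestIdx_spec {p : ℕ} (hp : 0 < p) (n : ℕ) (x : ℤ) :
    2 * (p : ℤ) ^ n * nearestIdx p n x ≤ 2 * x + (p : ℤ) ^ n ∧
      2 * x + (p : ℤ) ^ n < 2 * (p : ℤ) ^ n * nearestIdx p n x + 2 * (p : ℤ) ^ n := by
  have hq : (0 : ℤ) < (p : ℤ) ^ n := by positivity
  unfold nearestIdx
  constructor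
  · exact Int.mul_ediv_self_le (by positivity)
  · have := Int.lt_mul_ediv_self_add (x := 2 * x + (p : ℤ) ^ n) (k := 2 * (p : ℤ) ^ n)
      (by positivity)
    exact this

theorem nearestIdx_eq {p : ℕ} (hp : 0 < p) (n : ℕ) (x k : ℤ)
    (h1 : 2 * (p : ℤ) ^ n * k ≤ 2 * x + (p : ℤ) ^ n)
    (h2 : 2 * x + (p : ℤ) ^ n < 2 * (p : ℤ) ^ n * k + 2 * (p : ℤ) ^ n) : nearestIdx p n x = k := by
  have hq : (0 : ℤ) < (p : ℤ) ^ n := by positivity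
  unfold nearestIdx
  rw [Int.ediv_eq_iff_of_pos (by positivity)]
  constructor <;> linarith

theorem nearestIdx_pow_mul {p : ℕ} (hp : 0 < p) (n : ℕ) (k : ℤ) :
    nearestIdx p n ((p : ℤ) ^ n * k) = k := by
  have hq : (0 : ℤ) < (p : ℤ) ^ n := by positivity
  apply nearestIdx_eq hp <;> linarith

/-- Rounding jumps when `x + 1 / 2` is a half-odd multiple of `p ^ n`, that is, `2 * x + 1 = p ^ n *
k` with `k` odd; oddness of `k` is automatic. -/
theorem nearestIdx_succ {p : ℕ} (hp : Odd p) (n : ℕ) (x : ℤ) :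
    nearestIdx p n (x + 1) = nearestIdx p n x + if (p : ℤ) ^ n ∣ 2 * x + 1 then 1 else 0 := by
  have hq : (0 : ℤ) < (p : ℤ) ^ n := by have := hp.pos; positivity
  have hodd : Odd ((p : ℤ) ^ n) := by
    have : Odd (p : ℤ) := by exact_mod_cast hp
    exact this.pow
  obtain ⟨h1, h2⟩ := nearestIdx_spec hp.pos n x
  apply nearestIdx_eq hp.pos <;> generalize (p : ℤ) ^ n = q at * <;>
    generalize nearestIdx p n x = e at * <;> obtain ⟨s, rfl⟩ := hodd
  all_goals
    split_ifs with h
    · obtain ⟨k, hk⟩ := h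
      have hk2 : Odd k := by
        have : Odd ((2 * s + 1) * k) := ⟨x, hk ▸ rfl⟩
        exact (Int.odd_mul.1 this).2
      obtain ⟨j, rfl⟩ := hk2
      have : j = e := by
        have a1 : (2 * s + 1) * (e - j) < 2 * s + 1 := by nlinarith
        have a2 : (2 * s + 1) * (j - e) < 2 * s + 1 := by nlinarith
        have a3 : e - j < 1 := by by_contra! hh; nlinarith
        have a4 : j - e < 1 := by by_contra! hh; nlinarith
        omega
      subst this
      nlinarith
    · first
      | nlinarith
      | by_contra! hh
        apply h
        refine ⟨2 * e + 1, ?_⟩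
        have e1 : 2 * (2 * s + 1) * e = 2 * ((2 * s + 1) * e) := by ring
        have e2 : (2 * s + 1) * (2 * e + 1) = 2 * ((2 * s + 1) * e) + (2 * s + 1) := by ring
        have e3 : 2 * (2 * s + 1) * (e + 0) = 2 * ((2 * s + 1) * e) := by ring
        rw [e1] at h1 h2
        rw [e3] at hh
        rw [e2]
        generalize (2 * s + 1) * e = f at *
        omega

section
variable {p a b : ℕ}

theorem pot_succ (hp : Odd p) (n : ℕ) (x : ℤ) :
    pot p a b n (x + 1) = pot p a b n x + if (p : ℤ) ^ n ∣ 2 * x + 1 then (b : ℝ) else a := by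
  unfold pot
  rw [nearestIdx_succ hp]
  split_ifs <;> push_cast <;> ring

theorem le_pot_sub (hp : Odd p) (hab : a < b) (n : ℕ) {x y : ℤ} (h : x ≤ y) :
    (a : ℝ) * (y - x) ≤ pot p a b n y - pot p a b n x := by
  induction y, h using Int.leInduction with
  | base => simp
  | succ y hy ih =>
    have hab' : (a : ℝ) < b := by exact_mod_cast hab
    rw [pot_succ hp]
    push_cast
    split_ifs <;> linarith

theorem pot_sub_le (hp : Odd p) (hab : a < b) (n : ℕ) {x y : ℤ} (h : x ≤ y) :
    pot p a b n y - pot p a b n x ≤ (b : ℝ) * (y - x) := by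
  induction y, h using Int.leInduction with
  | base => simp
  | succ y hy ih =>
    have hab' : (a : ℝ) < b := by exact_mod_cast hab
    rw [pot_succ hp]
    push_cast
    split_ifs <;> linarith

/-- A slow step at the coarser level is also slow at the finer one, since `p ^ m ∣ p ^ n`. -/
theorem pot_sub_le_pot_sub (hp : Odd p) (hab : a < b) {m n : ℕ} (hmn : m ≤ n) {x y : ℤ}
    (h : x ≤ y) :
    pot p a b n y - pot p a b n x ≤ pot p a b m y - pot p a b m x := by
  induction y, h using Int.leInduction with
  | base => simp
  | succ y hy ih =>
    have hab' : (a : ℝ) < b := by exact_mod_cast hab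
    rw [pot_succ hp, pot_succ hp]
    split_ifs with h1 h2
    · linarith
    · exact absurd ((pow_dvd_pow _ hmn).trans h1) h2
    · linarith
    · linarith

theorem abs_pot_sub (hp : Odd p) (hab : a < b) (n : ℕ) {x y : ℤ} (h : x ≤ y) :
    |pot p a b n x - pot p a b n y| = pot p a b n y - pot p a b n x := by
  have h1 := le_pot_sub (a := a) (b := b) hp hab n h
  have h2 : (x : ℝ) ≤ y := by exact_mod_cast h
  have h3 : (0 : ℝ) ≤ a * (y - x) := mul_nonneg (by positivity) (by linarith)
  rw [abs_sub_comm, abs_of_nonneg (by linarith)]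

theorem mul_abs_le_abs_pot (hp : Odd p) (hab : a < b) (n : ℕ) (x y : ℤ) :
    (a : ℝ) * |(x : ℝ) - y| ≤ |pot p a b n x - pot p a b n y| := by
  wlog h : x ≤ y generalizing x y
  · rw [abs_sub_comm, abs_sub_comm (pot _ _ _ _ _)]
    exact this y x (by omega)
  rw [abs_pot_sub hp hab n h, abs_sub_comm, abs_of_nonneg (by
    have : (x : ℝ) ≤ y := by exact_mod_cast h
    linarith)]
  exact le_pot_sub hp hab n h

theorem abs_pot_le_mul_abs (hp : Odd p) (hab : a < b) (n : ℕ) (x y : ℤ) :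
    |pot p a b n x - pot p a b n y| ≤ (b : ℝ) * |(x : ℝ) - y| := by
  wlog h : x ≤ y generalizing x y
  · rw [abs_sub_comm, abs_sub_comm (x : ℝ)]
    exact this y x (by omega)
  rw [abs_pot_sub hp hab n h, abs_sub_comm (x : ℝ), abs_of_nonneg (a := (y : ℝ) - x) (by
    have : (x : ℝ) ≤ y := by exact_mod_cast h
    linarith)]
  exact pot_sub_le hp hab n h

theorem abs_pot_le_abs_pot (hp : Odd p) (hab : a < b) {m n : ℕ} (hmn : m ≤ n) (x y : ℤ) :
    |pot p a b n x - pot p a b n y| ≤ |pot p a b m x - pot p a b m y| := by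
  wlog h : x ≤ y generalizing x y
  · rw [abs_sub_comm, abs_sub_comm (pot p a b m x)]
    exact this y x (by omega)
  rw [abs_pot_sub hp hab n h, abs_pot_sub hp hab m h]
  exact pot_sub_le_pot_sub hp hab hmn h

theorem abs_pot_eq (hab : a < b) (hp : Odd p) (n : ℕ) (x y : ℤ) :
    |pot p a b n x - pot p a b n y| =
      a * |(x : ℝ) - y| + ((b : ℝ) - a) * |(nearestIdx p n x : ℝ) - nearestIdx p n y| := by
  wlog h : x ≤ y generalizing x y
  · rw [abs_sub_comm, abs_sub_comm (x : ℝ), abs_sub_comm (nearestIdx p n x : ℝ)]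
    exact this y x (by omega)
  have h' : (x : ℝ) ≤ y := by exact_mod_cast h
  have hq : (0 : ℤ) < (p : ℤ) ^ n := by have := hp.pos; positivity
  have hi : nearestIdx p n x ≤ nearestIdx p n y := by
    unfold nearestIdx
    exact Int.ediv_le_ediv (by positivity) (by linarith)
  have hi' : (nearestIdx p n x : ℝ) ≤ nearestIdx p n y := by exact_mod_cast hi
  rw [abs_pot_sub hp hab n h, abs_sub_comm (x : ℝ), abs_sub_comm (nearestIdx p n x : ℝ),
    abs_of_nonneg (a := (y : ℝ) - x) (by linarith), abs_of_nonneg (by linarith)]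
  unfold pot
  ring

theorem pow_mul_abs_nearestIdx (hp : 0 < p) (n : ℕ) (x y : ℤ) :
    (p : ℝ) ^ n * |(nearestIdx p n x : ℝ) - nearestIdx p n y| ≤ |(x : ℝ) - y| + (p : ℝ) ^ n ∧
    |(x : ℝ) - y| ≤ (p : ℝ) ^ n * |(nearestIdx p n x : ℝ) - nearestIdx p n y| + (p : ℝ) ^ n := by
  have hq : (0 : ℝ) < (p : ℝ) ^ n := by positivity
  obtain ⟨h1, h2⟩ := nearestIdx_spec hp n x
  obtain ⟨h3, h4⟩ := nearestIdx_spec hp n y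
  have h1' : 2 * (p : ℝ) ^ n * nearestIdx p n x ≤ 2 * x + (p : ℝ) ^ n := by exact_mod_cast h1
  have h2' : 2 * x + (p : ℝ) ^ n < 2 * (p : ℝ) ^ n * nearestIdx p n x + 2 * (p : ℝ) ^ n := by
    exact_mod_cast h2
  have h3' : 2 * (p : ℝ) ^ n * nearestIdx p n y ≤ 2 * y + (p : ℝ) ^ n := by exact_mod_cast h3
  have h4' : 2 * y + (p : ℝ) ^ n < 2 * (p : ℝ) ^ n * nearestIdx p n y + 2 * (p : ℝ) ^ n := by
    exact_mod_cast h4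
  rw [show (p : ℝ) ^ n * |(nearestIdx p n x : ℝ) - nearestIdx p n y| =
    |(p : ℝ) ^ n * nearestIdx p n x - (p : ℝ) ^ n * nearestIdx p n y| by
      rw [← mul_sub, abs_mul, abs_of_pos hq]]
  constructor
  · rcases abs_cases ((x : ℝ) - y) with h | h <;> rw [abs_le] <;> constructor <;> linarith
  · rw [← sub_le_iff_le_add, le_abs']
    rcases abs_cases ((x : ℝ) - y) with h | h
    · right; linarith
    · left; linarith

/-- Going from a point on a line of level `m` to a line of level `m + 1` is strictly cheaper
along lines of level `m + 1` than along lines of level `m`. -/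
theorem abs_pot_lt_abs_pot (hp : Odd p) (h3 : 3 ≤ p) (hab : a < b) {m : ℕ} {x y : ℤ}
    (hx : (p : ℤ) ^ m ∣ x) (hx' : ¬ (p : ℤ) ^ (m + 1) ∣ x) (hy : (p : ℤ) ^ (m + 1) ∣ y) :
    |pot p a b (m + 1) x - pot p a b (m + 1) y| < |pot p a b m x - pot p a b m y| := by
  obtain ⟨i, rfl⟩ := hx
  obtain ⟨j, rfl⟩ := hy
  have hq : (0 : ℤ) < (p : ℤ) ^ m := by have := hp.pos; positivity
  have hp3 : (3 : ℤ) ≤ p := by exact_mod_cast h3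
  have hne : i ≠ p * j := by
    rintro rfl
    exact hx' ⟨j, by ring⟩
  have hab' : (a : ℝ) < b := by exact_mod_cast hab
  rw [abs_pot_eq hab hp, abs_pot_eq hab hp, nearestIdx_pow_mul hp.pos, nearestIdx_pow_mul hp.pos,
    show (p : ℤ) ^ (m + 1) * j = (p : ℤ) ^ m * (p * j) by ring, nearestIdx_pow_mul hp.pos]
  obtain ⟨h1, h2⟩ := nearestIdx_spec hp.pos (m + 1) ((p : ℤ) ^ m * i)
  generalize nearestIdx p (m + 1) ((p : ℤ) ^ m * i) = e at *
  have h1 : 2 * (p : ℤ) * e ≤ 2 * i + p := by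
    refine le_of_mul_le_mul_left ?_ hq
    rw [pow_succ] at h1
    linarith
  have h2 : 2 * i + (p : ℤ) < 2 * p * e + 2 * p := by
    refine lt_of_mul_lt_mul_left ?_ hq.le
    rw [pow_succ] at h2
    linarith
  -- Both sides count slow steps. Since `e` is `i / p` rounded, a change of `f ≠ 0` in the coarse
  -- index needs a change of at least `p * (|f| - 1 / 2) > |f|` in the fine one.
  have key : |e - j| < |i - p * j| := by
    obtain ⟨s, rfl⟩ : ∃ s, i = p * j + s := ⟨i - p * j, by ring⟩
    obtain ⟨f, rfl⟩ : ∃ f, e = j + f := ⟨e - j, by ring⟩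
    have hs : s ≠ 0 := by rintro rfl; simp at hne
    have g1 : 2 * (p : ℤ) * f ≤ 2 * s + p := by linarith
    have g2 : 2 * s + (p : ℤ) < 2 * p * f + 2 * p := by linarith
    rw [show j + f - j = f by ring, show p * j + s - p * j = s by ring]
    rcases lt_trichotomy f 0 with hf | rfl | hf
    · rw [abs_of_neg hf, lt_abs]
      right
      by_contra! hh
      nlinarith
    · simpa using hs
    · rw [abs_of_pos hf, lt_abs]
      left
      by_contra! hh
      nlinarith
  have key' : |(e : ℝ) - j| < |(i : ℝ) - (p * j : ℤ)| := by exact_mod_cast key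
  have := mul_lt_mul_of_pos_left key' (sub_pos.2 hab')
  linarith

end

/-! ### Edge weights of the slow-fast graph and walks along lines. -/

/-- The parameters of a slow-fast graph, with the hypotheses on them. -/
structure SlowFast where
  (p a b : ℕ)
  odd : Odd p
  three_le : 3 ≤ p
  a_pos : 0 < a
  lt : a < b

theorem squareLattice_adj_iff {z t : ℤ × ℤ} : squareLattice.Adj z t ↔
    (t.2 = z.2 ∧ (t.1 = z.1 + 1 ∨ t.1 = z.1 - 1)) ∨
      (t.1 = z.1 ∧ (t.2 = z.2 + 1 ∨ t.2 = z.2 - 1)) := by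
  change |z.1 - t.1| + |z.2 - t.2| = 1 ↔ _
  rcases abs_cases (z.1 - t.1) with h | h <;> rcases abs_cases (z.2 - t.2) with h' | h' <;> omega

/-- The reflection of the square lattice in the diagonal. -/
def squareLatticeSwap : squareLattice →g squareLattice where
  toFun := Prod.swap
  map_rel' := by
    intro z t h
    change |z.2 - t.2| + |z.1 - t.1| = 1
    rw [add_comm]
    exact h

theorem squareLatticeSwap_apply (z : ℤ × ℤ) : squareLatticeSwap z = z.swap := rfl

theorem isSlow_swap {p : ℕ} {z t : ℤ × ℤ} (h : IsSlow p s(z, t)) :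
    IsSlow p s(z.swap, t.swap) := by
  obtain ⟨n, x, y, ⟨h1, h2⟩ | ⟨h1, h2⟩⟩ := h
  · refine ⟨n, y, x, .inr ⟨h1, ?_⟩⟩
    have := congrArg (Sym2.map Prod.swap) h2
    simpa using this
  · refine ⟨n, y, x, .inl ⟨h1, ?_⟩⟩
    have := congrArg (Sym2.map Prod.swap) h2
    simpa using this

theorem isSlow_horizontal_iff {p : ℕ} (hp : Odd p) (x y : ℤ) :
    IsSlow p s((x, y), (x + 1, y)) ↔
      ∃ n : ℕ, (p : ℤ) ^ n ∣ y ∧ ¬ (p : ℤ) ^ (n + 1) ∣ y ∧ (p : ℤ) ^ n ∣ 2 * x + 1 := by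
  have hodd : ∀ n : ℕ, Odd ((p : ℤ) ^ n) := fun n => by
    have : Odd (p : ℤ) := by exact_mod_cast hp
    exact this.pow
  have hq : ∀ n : ℕ, (0 : ℤ) < (p : ℤ) ^ n := fun n => by have := hp.pos; positivity
  constructor
  · rintro ⟨n, i, j, ⟨h1, h2⟩ | ⟨h1, h2⟩⟩
    · obtain ⟨s, hs⟩ := hodd n
      refine ⟨n, ?_⟩
      rw [Sym2.eq_iff] at h2
      simp only [Prod.mk.injEq] at h2
      have hj : y = (p : ℤ) ^ n * j := by omega
      refine ⟨⟨j, hj⟩, ?_, i + (i + 1), ?_⟩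
      · rw [hj, pow_succ]
        intro h
        exact h1 (Int.dvd_of_mul_dvd_mul_left (hq n).ne' h)
      · have : (p : ℤ) ^ n * (i + (i + 1)) = 2 * ((p : ℤ) ^ n * i) + (p : ℤ) ^ n := by ring
        omega
    · exfalso
      obtain ⟨s, hs⟩ := hodd n
      rw [Sym2.eq_iff] at h2
      simp only [Prod.mk.injEq] at h2
      omega
  · rintro ⟨n, ⟨j, rfl⟩, h1, ⟨k, hk⟩⟩
    have hk2 : Odd k := by
      have : Odd ((p : ℤ) ^ n * k) := ⟨x, hk ▸ rfl⟩
      exact (Int.odd_mul.1 this).2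
    obtain ⟨i, rfl⟩ := hk2
    obtain ⟨s, hs⟩ := hodd n
    refine ⟨n, i, j, .inl ⟨?_, ?_⟩⟩
    · rintro ⟨l, rfl⟩
      exact h1 ⟨l, by ring⟩
    · have : (p : ℤ) ^ n * (2 * i + 1) = 2 * ((p : ℤ) ^ n * i) + (p : ℤ) ^ n := by ring
      rw [Sym2.eq_iff]
      simp only [Prod.mk.injEq]
      refine .inl ⟨⟨?_, trivial⟩, ?_, trivial⟩ <;> omega

namespace SlowFast

variable (S : SlowFast)

/-- The weighted graph with the given parameters. -/
noncomputable abbrev graph : WeightedGraph squareLattice :=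
  slowFastGraph S.p S.a S.b S.a_pos (S.a_pos.trans S.lt)

/-- The potential along a line of level exactly `n`. -/
noncomputable abbrev φ (n : ℕ) (x : ℤ) : ℝ := pot S.p S.a S.b n x

/-- The weight of an edge. -/
noncomputable abbrev wt {z t : ℤ × ℤ} (h : squareLattice.Adj z t) : ℝ :=
  S.graph.weight ⟨s(z, t), squareLattice.mem_edgeSet.mpr h⟩

theorem a_pos' : (0 : ℝ) < S.a := by exact_mod_cast S.a_pos
theorem lt' : (S.a : ℝ) < S.b := by exact_mod_cast S.lt
theorem p_pos : 0 < S.p := S.odd.pos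
theorem pow_pos (n : ℕ) : (0 : ℤ) < (S.p : ℤ) ^ n := by have := S.p_pos; positivity

open Classical in
theorem wt_eq {z t : ℤ × ℤ} (h : squareLattice.Adj z t) :
    S.wt h = if IsSlow S.p s(z, t) then (S.b : ℝ) else S.a := rfl

theorem wt_symm {z t : ℤ × ℤ} (h : squareLattice.Adj z t) : S.wt h.symm = S.wt h := by
  rw [wt_eq, wt_eq, Sym2.eq_swap]

theorem le_wt {z t : ℤ × ℤ} (h : squareLattice.Adj z t) : S.a ≤ S.wt h := by
  rw [wt_eq]
  split_ifs
  · exact S.lt'.le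
  · rfl

theorem wt_swap {z t : ℤ × ℤ} (h : squareLattice.Adj z t) :
    S.wt (squareLatticeSwap.map_rel h) = S.wt h := by
  classical
  rw [wt_eq, wt_eq]
  have : IsSlow S.p s(squareLatticeSwap z, squareLatticeSwap t) ↔ IsSlow S.p s(z, t) :=
    ⟨fun h => by simpa [squareLatticeSwap_apply] using isSlow_swap h, isSlow_swap⟩
  rw [if_congr this rfl rfl]

theorem cost_swap {u v : ℤ × ℤ} (γ : squareLattice.Walk u v) :
    S.graph.cost (γ.map squareLatticeSwap) = S.graph.cost γ := by
  induction γ with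
  | nil => rfl
  | cons h γ ih =>
    rw [SimpleGraph.Walk.map_cons, WeightedGraph.cost_cons, WeightedGraph.cost_cons, ih]
    congr 1
    exact S.wt_swap h

/-- The divisibility `p ^ n ∣ 2 * x + 1` is more restrictive for larger `n`, so a row of exact level
at most `m` has all the slow edges that `φ m` counts, and a row of level `m` or higher has no
others. -/
theorem wt_horizontal (x y : ℤ) (h : squareLattice.Adj (x, y) (x + 1, y)) (m : ℕ) :
    (¬ (S.p : ℤ) ^ (m + 1) ∣ y → S.φ m (x + 1) - S.φ m x ≤ S.wt h) ∧
      ((S.p : ℤ) ^ m ∣ y → S.wt h ≤ S.φ m (x + 1) - S.φ m x) := by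
  classical
  have hlt := S.lt'
  rw [wt_eq, φ, pot_succ S.odd, if_congr (isSlow_horizontal_iff S.odd x y) rfl rfl]
  constructor
  · intro hy
    split_ifs with h1 h2
    · linarith
    · exfalso
      apply h2
      -- The least such `n` is the exact level of the row.
      have hex : ∃ n, ¬ (S.p : ℤ) ^ (n + 1) ∣ y := ⟨m, hy⟩
      have hle : Nat.find hex ≤ m := Nat.find_min' hex hy
      refine ⟨Nat.find hex, ?_, Nat.find_spec hex, (pow_dvd_pow _ hle).trans h1⟩
      rcases hn : Nat.find hex with _ | k
      · simp
      · have := Nat.find_min hex (m := k) (by omega)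
        exact not_not.1 this
    · linarith
    · linarith
  · intro hy
    split_ifs with h1 h2
    · linarith
    · exfalso
      obtain ⟨n, h3, h4, h5⟩ := h1
      have : m ≤ n := by
        by_contra! hh
        exact h4 ((pow_dvd_pow _ hh).trans hy)
      exact h2 ((pow_dvd_pow _ this).trans h5)
    · linarith
    · linarith

theorem abs_φ_succ (m : ℕ) (x : ℤ) : |S.φ m x - S.φ m (x + 1)| = S.φ m (x + 1) - S.φ m x :=
  abs_pot_sub S.odd S.lt m (by omega)

theorem wt_horizontal' {z t : ℤ × ℤ} (h : squareLattice.Adj z t) (hzt : t.2 = z.2) (m : ℕ) :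
    (¬ (S.p : ℤ) ^ (m + 1) ∣ z.2 → |S.φ m z.1 - S.φ m t.1| ≤ S.wt h) ∧
      ((S.p : ℤ) ^ m ∣ z.2 → S.wt h ≤ |S.φ m z.1 - S.φ m t.1|) := by
  obtain ⟨x, y⟩ := z
  obtain ⟨x', y'⟩ := t
  simp only at hzt
  subst hzt
  have : x' = x + 1 ∨ x = x' + 1 := by
    have := squareLattice_adj_iff.1 h
    simp only at this
    omega
  rcases this with rfl | rfl
  · simp only [abs_φ_succ]
    exact S.wt_horizontal _ _ h m
  · simp only [abs_sub_comm _ (S.φ m x'), abs_φ_succ]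
    rw [← S.wt_symm]
    exact S.wt_horizontal _ _ h.symm m

theorem wt_vertical' {z t : ℤ × ℤ} (h : squareLattice.Adj z t) (hzt : t.1 = z.1) (m : ℕ) :
    (¬ (S.p : ℤ) ^ (m + 1) ∣ z.1 → |S.φ m z.2 - S.φ m t.2| ≤ S.wt h) ∧
      ((S.p : ℤ) ^ m ∣ z.1 → S.wt h ≤ |S.φ m z.2 - S.φ m t.2|) := by
  rw [← S.wt_swap]
  exact S.wt_horizontal' (squareLatticeSwap.map_rel h) hzt m

theorem a_mul_le_abs_φ (m : ℕ) (x y : ℤ) : (S.a : ℝ) * |(x : ℝ) - y| ≤ |S.φ m x - S.φ m y| :=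
  mul_abs_le_abs_pot S.odd S.lt m x y

theorem abs_φ_le (m : ℕ) (x y : ℤ) : |S.φ m x - S.φ m y| ≤ (S.b : ℝ) * |(x : ℝ) - y| :=
  abs_pot_le_mul_abs S.odd S.lt m x y

theorem exists_horizontal_walk {m : ℕ} {y : ℤ} (hy : (S.p : ℤ) ^ m ∣ y) {x x' : ℤ}
    (h : x ≤ x') :
    ∃ γ : squareLattice.Walk (x, y) (x', y), S.graph.cost γ ≤ S.φ m x' - S.φ m x := by
  induction x', h using Int.leInduction with
  | base => exact ⟨.nil, by simp [WeightedGraph.cost_nil]⟩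
  | succ x' _ ih =>
    obtain ⟨γ, hγ⟩ := ih
    have h : squareLattice.Adj (x', y) (x' + 1, y) := by simp [squareLattice_adj_iff]
    refine ⟨γ.append (.cons h .nil), ?_⟩
    rw [WeightedGraph.cost_append, WeightedGraph.cost_cons, WeightedGraph.cost_nil]
    have := (S.wt_horizontal x' y h m).2 hy
    linarith

theorem exists_horizontal_walk' {m : ℕ} {y : ℤ} (hy : (S.p : ℤ) ^ m ∣ y) (x x' : ℤ) :
    ∃ γ : squareLattice.Walk (x, y) (x', y), S.graph.cost γ ≤ |S.φ m x - S.φ m x'| := by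
  rcases le_total x x' with h | h
  · rw [abs_pot_sub S.odd S.lt m h]
    exact S.exists_horizontal_walk hy h
  · obtain ⟨γ, hγ⟩ := S.exists_horizontal_walk hy h
    refine ⟨γ.reverse, ?_⟩
    rw [WeightedGraph.cost_reverse, abs_sub_comm, abs_pot_sub S.odd S.lt m h]
    exact hγ

theorem exists_vertical_walk {m : ℕ} {x : ℤ} (hx : (S.p : ℤ) ^ m ∣ x) (y y' : ℤ) :
    ∃ γ : squareLattice.Walk (x, y) (x, y'), S.graph.cost γ ≤ |S.φ m y - S.φ m y'| := by
  obtain ⟨γ, hγ⟩ := S.exists_horizontal_walk' hx y y'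
  exact ⟨γ.map squareLatticeSwap, (S.cost_swap γ).trans_le hγ⟩

theorem dist_horizontal_le {m : ℕ} {y : ℤ} (hy : (S.p : ℤ) ^ m ∣ y) (x x' : ℤ) :
    S.graph.dist (x, y) (x', y) ≤ |S.φ m x - S.φ m x'| := by
  obtain ⟨γ, hγ⟩ := S.exists_horizontal_walk' hy x x'
  exact (S.graph.dist_le_cost γ).trans hγ

theorem dist_vertical_le {m : ℕ} {x : ℤ} (hx : (S.p : ℤ) ^ m ∣ x) (y y' : ℤ) :
    S.graph.dist (x, y) (x, y') ≤ |S.φ m y - S.φ m y'| := by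
  obtain ⟨γ, hγ⟩ := S.exists_vertical_walk hx y y'
  exact (S.graph.dist_le_cost γ).trans hγ

end SlowFast

theorem squareLattice_preconnected : squareLattice.Preconnected := by
  intro u v
  -- Any admissible parameters serve: only the existence of the walks is used.
  let S : SlowFast := ⟨3, 1, 2, by decide, le_rfl, by decide, by decide⟩
  obtain ⟨γ, -⟩ := S.exists_horizontal_walk' (m := 0) (y := u.2) (by simp) u.1 v.1
  obtain ⟨δ, -⟩ := S.exists_vertical_walk (m := 0) (x := v.1) (by simp) u.2 v.2
  exact ⟨γ.append δ⟩

/-! ### Upper and lower bounds for the weighted distance. -/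

namespace SlowFast

variable (S : SlowFast)

theorem dist_comm (u v : ℤ × ℤ) : S.graph.dist u v = S.graph.dist v u :=
  S.graph.dist_comm squareLattice_preconnected u v

theorem dist_triangle (u v w : ℤ × ℤ) :
    S.graph.dist u w ≤ S.graph.dist u v + S.graph.dist v w :=
  S.graph.dist_triangle squareLattice_preconnected u v w

theorem dist_swap (u v : ℤ × ℤ) : S.graph.dist u.swap v.swap = S.graph.dist u v := by
  have key : ∀ u v : ℤ × ℤ, S.graph.dist u.swap v.swap ≤ S.graph.dist u v := fun u v =>
    S.graph.le_dist squareLattice_preconnected fun γ => by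
      rw [← S.cost_swap]
      exact S.graph.dist_le_cost _
  exact (key u v).antisymm (by simpa using key u.swap v.swap)

theorem dist_le (u v : ℤ × ℤ) :
    S.graph.dist u v ≤ S.b * (|(u.1 : ℝ) - v.1| + |(u.2 : ℝ) - v.2|) := by
  have h1 := S.dist_horizontal_le (m := 0) (y := u.2) (by simp) u.1 v.1
  have h2 := S.dist_vertical_le (m := 0) (x := v.1) (by simp) u.2 v.2
  have h3 := S.dist_triangle u (v.1, u.2) v
  have h4 := S.abs_φ_le 0 u.1 v.1
  have h5 := S.abs_φ_le 0 u.2 v.2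
  simp only [Prod.mk.eta] at *
  linarith

/-- Edges leaving points off the lines of level `m + 1` dominate the potentials of level `m`. -/
theorem cell_lipschitz (m : ℕ) {x y : ℤ × ℤ} (h : squareLattice.Adj x y)
    (h1 : ¬ (S.p : ℤ) ^ (m + 1) ∣ x.1) (h2 : ¬ (S.p : ℤ) ^ (m + 1) ∣ x.2) (t : ℤ × ℤ) :
    |S.φ m x.1 - S.φ m t.1| + |S.φ m x.2 - S.φ m t.2| ≤
      S.wt h + (|S.φ m y.1 - S.φ m t.1| + |S.φ m y.2 - S.φ m t.2|) := by
  rcases squareLattice_adj_iff.1 h with ⟨h3, -⟩ | ⟨h3, -⟩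
  · have := (S.wt_horizontal' h h3 m).1 h2
    have := abs_sub_le (S.φ m x.1) (S.φ m y.1) (S.φ m t.1)
    rw [h3]
    linarith
  · have := (S.wt_vertical' h h3 m).1 h1
    have := abs_sub_le (S.φ m x.2) (S.φ m y.2) (S.φ m t.2)
    rw [h3]
    linarith

/-- All rows inside the strip have exact level at most `m`, but columns of any level cross it, so
vertical edges are only known to cost at least `a`. -/
theorem strip_lipschitz (m : ℕ) {x y : ℤ × ℤ} (h : squareLattice.Adj x y)
    (h2 : ¬ (S.p : ℤ) ^ (m + 1) ∣ x.2) (t : ℤ × ℤ) :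
    |S.φ m x.1 - S.φ m t.1| + S.a * |(x.2 : ℝ) - t.2| ≤
      S.wt h + (|S.φ m y.1 - S.φ m t.1| + S.a * |(y.2 : ℝ) - t.2|) := by
  rcases squareLattice_adj_iff.1 h with ⟨h3, -⟩ | ⟨h3, h4⟩
  · have := (S.wt_horizontal' h h3 m).1 h2
    have := abs_sub_le (S.φ m x.1) (S.φ m y.1) (S.φ m t.1)
    rw [h3]
    linarith
  · have h5 := S.le_wt h
    have h6 : |(x.2 : ℝ) - t.2| ≤ 1 + |(y.2 : ℝ) - t.2| := by
      have : |(x.2 : ℝ) - y.2| = 1 := by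
        rcases h4 with h4 | h4 <;> rw [h4] <;> push_cast <;> simp
      have := abs_sub_le (x.2 : ℝ) y.2 t.2
      linarith
    have := mul_le_mul_of_nonneg_left h6 S.a_pos'.le
    rw [h3]
    linarith

theorem le_dist (u v : ℤ × ℤ) :
    S.a * (|(u.1 : ℝ) - v.1| + |(u.2 : ℝ) - v.2|) ≤ S.graph.dist u v := by
  refine S.graph.le_dist squareLattice_preconnected fun γ => ?_
  refine S.graph.le_cost_of_forall_mem (fun _ => True)
    (fun u v => S.a * (|(u.1 : ℝ) - v.1| + |(u.2 : ℝ) - v.2|)) (fun t => by simp) ?_ γ (by simp)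
  intro x y h _ t
  have h5 := S.le_wt h
  rcases squareLattice_adj_iff.1 h with ⟨h3, h4⟩ | ⟨h3, h4⟩
  · have h6 : |(x.1 : ℝ) - t.1| ≤ 1 + |(y.1 : ℝ) - t.1| := by
      have : |(x.1 : ℝ) - y.1| = 1 := by
        rcases h4 with h4 | h4 <;> rw [h4] <;> push_cast <;> simp
      have := abs_sub_le (x.1 : ℝ) y.1 t.1
      linarith
    have := mul_le_mul_of_nonneg_left h6 S.a_pos'.le
    rw [h3]
    linarith
  · have h6 : |(x.2 : ℝ) - t.2| ≤ 1 + |(y.2 : ℝ) - t.2| := by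
      have : |(x.2 : ℝ) - y.2| = 1 := by
        rcases h4 with h4 | h4 <;> rw [h4] <;> push_cast <;> simp
      have := abs_sub_le (x.2 : ℝ) y.2 t.2
      linarith
    have := mul_le_mul_of_nonneg_left h6 S.a_pos'.le
    rw [h3]
    linarith

end SlowFast

/-! ### Geodesics crossing cells and strips. -/

theorem not_dvd_of_lt_of_lt {Q X x : ℤ} (hX : Q ∣ X) (h1 : X < x) (h2 : x < X + Q) : ¬ Q ∣ x := by
  intro h
  have := Int.le_of_dvd (by omega) (dvd_sub h hX)
  omega

theorem abs_nearestIdx_le_one {p : ℕ} (hp : 0 < p) (n : ℕ) {x y : ℤ}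
    (h : |(x : ℝ) - y| < (p : ℝ) ^ n) : |(nearestIdx p n x : ℝ) - nearestIdx p n y| ≤ 1 := by
  have h1 := (pow_mul_abs_nearestIdx hp n x y).1
  have hq : (0 : ℝ) < (p : ℝ) ^ n := by positivity
  have h2 : |(nearestIdx p n x : ℝ) - nearestIdx p n y| < 2 := by
    by_contra! hh
    have := mul_le_mul_of_nonneg_left hh hq.le
    linarith
  have h3 : |nearestIdx p n x - nearestIdx p n y| < 2 := by exact_mod_cast h2
  have h4 : |nearestIdx p n x - nearestIdx p n y| ≤ 1 := by omega
  exact_mod_cast h4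

theorem abs_sub_lt_of_lt {X Q x y : ℤ} (h1 : X < x) (h2 : x < X + Q) (h3 : X < y)
    (h4 : y < X + Q) : |(x : ℝ) - y| < Q := by
  have : |x - y| < Q := by rw [abs_lt]; omega
  exact_mod_cast this

/-- `z` lies in the open strip `(Y, Y + Q)` of heights. -/
def InStrip (Q Y : ℤ) (z : ℤ × ℤ) : Prop := Y < z.2 ∧ z.2 < Y + Q

/-- `z` lies in the open square `(X, X + Q) × (Y, Y + Q)`. -/
def InCell (Q X Y : ℤ) (z : ℤ × ℤ) : Prop := (X < z.1 ∧ z.1 < X + Q) ∧ Y < z.2 ∧ z.2 < Y + Q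

theorem exit_strip {Q Y : ℤ} {z t : ℤ × ℤ} (hz : InStrip Q Y z) (ht : ¬ InStrip Q Y t)
    (h : squareLattice.Adj z t) : t.2 = Y ∨ t.2 = Y + Q := by
  have := squareLattice_adj_iff.1 h
  unfold InStrip at *
  omega

theorem exit_cell {Q X Y : ℤ} {z t : ℤ × ℤ} (hz : InCell Q X Y z) (ht : ¬ InCell Q X Y t)
    (h : squareLattice.Adj z t) :
    ((t.1 = X ∨ t.1 = X + Q) ∧ Y < t.2 ∧ t.2 < Y + Q) ∨
      ((t.2 = Y ∨ t.2 = Y + Q) ∧ X < t.1 ∧ t.1 < X + Q) := by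
  have := squareLattice_adj_iff.1 h
  unfold InCell at *
  omega

namespace SlowFast

variable (S : SlowFast)

theorem abs_φ_mono {m n : ℕ} (h : m ≤ n) (x y : ℤ) :
    |S.φ n x - S.φ n y| ≤ |S.φ m x - S.φ m y| := abs_pot_le_abs_pot S.odd S.lt h x y

/-- The potentials of level `m` and of level `m + 1` between neighbouring lines of level `m + 1`. -/
theorem abs_φ_of_neighbouring {m : ℕ} {x y : ℤ} (hx : (S.p : ℤ) ^ (m + 1) ∣ x)
    (h : x = y + (S.p : ℤ) ^ (m + 1) ∨ y = x + (S.p : ℤ) ^ (m + 1)) :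
    |S.φ m x - S.φ m y| =
      |S.φ (m + 1) x - S.φ (m + 1) y| + ((S.b : ℝ) - S.a) * ((S.p : ℝ) - 1) := by
  obtain ⟨i, rfl⟩ := hx
  have hp : (3 : ℝ) ≤ S.p := by exact_mod_cast S.three_le
  obtain ⟨j, rfl, hj⟩ : ∃ j, y = (S.p : ℤ) ^ (m + 1) * j ∧ (i = j + 1 ∨ j = i + 1) := by
    rcases h with h | h
    · exact ⟨i - 1, by linarith, by omega⟩
    · exact ⟨i + 1, by linarith, by omega⟩
  rw [φ, φ, φ, φ, abs_pot_eq S.lt S.odd, abs_pot_eq S.lt S.odd, nearestIdx_pow_mul S.p_pos,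
    nearestIdx_pow_mul S.p_pos, pow_succ, mul_assoc, mul_assoc, nearestIdx_pow_mul S.p_pos,
    nearestIdx_pow_mul S.p_pos]
  have h1 : |(i : ℝ) - j| = 1 := by
    rcases hj with rfl | rfl <;> push_cast <;> simp
  have h2 : |(((S.p : ℤ) * i : ℤ) : ℝ) - ((S.p * j : ℤ) : ℝ)| = S.p := by
    push_cast
    rw [← mul_sub, abs_mul, h1, abs_of_nonneg (by linarith)]
    ring
  rw [h1, h2]
  ring

/-- After crossing a square of level `m + 1` from left to right (or from right to left), leaving
its strip of level `m + 1` is not optimal. -/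
theorem dist_lt_of_crossing {m : ℕ} {s t t' : ℤ × ℤ} {Y : ℤ} (hY : (S.p : ℤ) ^ (m + 1) ∣ Y)
    (hs : (S.p : ℤ) ^ (m + 1) ∣ s.1)
    (hst : s.1 = t.1 + (S.p : ℤ) ^ (m + 1) ∨ t.1 = s.1 + (S.p : ℤ) ^ (m + 1))
    (hs2 : Y < s.2 ∧ s.2 < Y + (S.p : ℤ) ^ (m + 1))
    (ht' : t'.2 = Y ∨ t'.2 = Y + (S.p : ℤ) ^ (m + 1)) :
    S.graph.dist s t' < |S.φ m s.1 - S.φ m t.1| + S.a * |(s.2 : ℝ) - t.2| +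
      (|S.φ m t.1 - S.φ m t'.1| + S.a * |(t.2 : ℝ) - t'.2|) := by
  have hlt := S.lt'
  have hp : (3 : ℝ) ≤ S.p := by exact_mod_cast S.three_le
  have ht'2 : (S.p : ℤ) ^ (m + 1) ∣ t'.2 := by
    rcases ht' with h | h <;> rw [h]
    · exact hY
    · exact dvd_add hY dvd_rfl
  have h1 := S.dist_vertical_le hs s.2 t'.2
  have h2 := S.dist_horizontal_le ht'2 s.1 t'.1
  have h3 := S.dist_triangle s (s.1, t'.2) t'
  -- A column of level `m + 1` has at most one slow edge on this stretch, which is shorter than `p ^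
  -- (m + 1)`.
  have h4 : |S.φ (m + 1) s.2 - S.φ (m + 1) t'.2| ≤ S.a * |(s.2 : ℝ) - t'.2| + (S.b - S.a) := by
    rw [φ, φ, abs_pot_eq S.lt S.odd]
    have : |(nearestIdx S.p (m + 1) s.2 : ℝ) - nearestIdx S.p (m + 1) t'.2| ≤ 1 := by
      apply abs_nearestIdx_le_one S.p_pos
      have : |s.2 - t'.2| < (S.p : ℤ) ^ (m + 1) := by rw [abs_lt]; omega
      exact_mod_cast this
    have := mul_le_mul_of_nonneg_left this (sub_nonneg.2 hlt.le)
    linarith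
  have h5 := abs_sub_le (S.φ (m + 1) s.1) (S.φ (m + 1) t.1) (S.φ (m + 1) t'.1)
  have h6 := S.abs_φ_mono (Nat.le_succ m) t.1 t'.1
  have h7 := S.abs_φ_of_neighbouring hs hst
  have h8 := mul_le_mul_of_nonneg_left (abs_sub_le (s.2 : ℝ) t.2 t'.2) S.a_pos'.le
  -- The detour pays for at most one slow edge and saves `p - 1 ≥ 2` of them.
  have h9 : (S.b : ℝ) - S.a < (S.b - S.a) * (S.p - 1) := by nlinarith
  simp only [Prod.mk.eta] at *
  simp only [Nat.succ_eq_add_one] at h6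
  linarith

/-- If a geodesic leaves the square of level `m + 1` of its vertex `w` through a vertical side, then
it starts in this square or stays in the horizontal strip of this square. -/
theorem inCell_or_inStrip {m : ℕ} {X Y : ℤ} {u v w t : ℤ × ℤ} (γ : squareLattice.Walk u w)
    (δ : squareLattice.Walk t v) (K : ℝ)
    (hK : |S.φ m w.1 - S.φ m t.1| + |S.φ m w.2 - S.φ m t.2| ≤ K)
    (hgeo : S.graph.cost γ + K + S.graph.cost δ ≤ S.graph.dist u v)
    (hX : (S.p : ℤ) ^ (m + 1) ∣ X) (hY : (S.p : ℤ) ^ (m + 1) ∣ Y)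
    (hw : InCell ((S.p : ℤ) ^ (m + 1)) X Y w) (hwm : (S.p : ℤ) ^ m ∣ w.1 ∨ (S.p : ℤ) ^ m ∣ w.2)
    (ht : t.1 = X ∨ t.1 = X + (S.p : ℤ) ^ (m + 1)) (ht2 : InStrip ((S.p : ℤ) ^ (m + 1)) Y t) :
    InCell ((S.p : ℤ) ^ (m + 1)) X Y u ∨
      (∀ z ∈ γ.support, InStrip ((S.p : ℤ) ^ (m + 1)) Y z) ∧
        ∀ z ∈ δ.support, InStrip ((S.p : ℤ) ^ (m + 1)) Y z := by
  have ha := S.a_pos'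
  have hcell : ∀ x y (h : squareLattice.Adj x y), InCell ((S.p : ℤ) ^ (m + 1)) X Y x → ∀ t : ℤ × ℤ,
      |S.φ m x.1 - S.φ m t.1| + |S.φ m x.2 - S.φ m t.2| ≤
        S.wt h + (|S.φ m y.1 - S.φ m t.1| + |S.φ m y.2 - S.φ m t.2|) := fun x y h hx t =>
    S.cell_lipschitz m h (not_dvd_of_lt_of_lt hX hx.1.1 hx.1.2)
      (not_dvd_of_lt_of_lt hY hx.2.1 hx.2.2) t
  have hstrip : ∀ x y (h : squareLattice.Adj x y), InStrip ((S.p : ℤ) ^ (m + 1)) Y x → ∀ t : ℤ × ℤ,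
      |S.φ m x.1 - S.φ m t.1| + S.a * |(x.2 : ℝ) - t.2| ≤
        S.wt h + (|S.φ m y.1 - S.φ m t.1| + S.a * |(y.2 : ℝ) - t.2|) := fun x y h hx t =>
    S.strip_lipschitz m h (not_dvd_of_lt_of_lt hY hx.1 hx.2) t
  have ht1 : (S.p : ℤ) ^ (m + 1) ∣ t.1 := by
    rcases ht with h | h <;> rw [h]
    · exact hX
    · exact dvd_add hX dvd_rfl
  have hw1 : ¬ (S.p : ℤ) ^ (m + 1) ∣ w.1 := not_dvd_of_lt_of_lt hX hw.1.1 hw.1.2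
  have hw2 : ¬ (S.p : ℤ) ^ (m + 1) ∣ w.2 := not_dvd_of_lt_of_lt hY hw.2.1 hw.2.2
  rcases S.graph.stays_or_exits (InCell ((S.p : ℤ) ^ (m + 1)) X Y)
    (fun x t => |S.φ m x.1 - S.φ m t.1| + |S.φ m x.2 - S.φ m t.2|) (fun t => by simp) hcell
    γ.reverse hw with hall | ⟨z, s, h, p₀, p₂, hγ, hp₀, hs, hc⟩
  · exact .inl (hall u (by simp))
  have hcost : S.graph.cost γ = S.graph.cost p₀ + S.wt h + S.graph.cost p₂ := by
    rw [← WeightedGraph.cost_reverse, hγ, WeightedGraph.cost_append, WeightedGraph.cost_cons]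
    ring
  change _ ≤ S.graph.cost p₀ + S.wt h at hc
  have hz : InCell ((S.p : ℤ) ^ (m + 1)) X Y z := hp₀ z (by simp)
  have hd : ∀ s' t', S.graph.dist u v ≤ S.graph.dist u s' + S.graph.dist s' t' +
      S.graph.dist t' v := fun s' t' => by
    have h1 := S.dist_triangle u s' v
    have h2 := S.dist_triangle s' t' v
    linarith
  have hp₂ : S.graph.dist u s ≤ S.graph.cost p₂ := by
    rw [S.dist_comm]
    exact S.graph.dist_le_cost _
  have hδ := S.graph.dist_le_cost δ
  -- The geodesic runs from `s` through `w` to `t`, so `dist s t` is at least the sum of both lower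
  -- bounds.
  have hst : |S.φ m w.1 - S.φ m s.1| + |S.φ m w.2 - S.φ m s.2| +
      (|S.φ m w.1 - S.φ m t.1| + |S.φ m w.2 - S.φ m t.2|) ≤ S.graph.dist s t := by
    have := hd s t
    linarith
  have e1 := abs_sub_comm (S.φ m s.1) (S.φ m w.1)
  have e2 := abs_sub_comm (S.φ m s.2) (S.φ m w.2)
  rcases exit_cell hz hs h with ⟨hs1, hs2⟩ | ⟨hs1, hs2⟩
  · by_cases hst1 : s.1 = t.1
    · exfalso
      -- Both exits on one side: the straight route along that side avoids the positive horizontal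
      -- cost of visiting `w`.
      have h1 := S.dist_vertical_le (hst1 ▸ ht1 : (S.p : ℤ) ^ (m + 1) ∣ s.1) s.2 t.2
      rw [show (s.1, t.2) = t by rw [hst1]] at h1
      have h2 := S.abs_φ_mono (Nat.le_succ m) s.2 t.2
      have h3 := abs_sub_le (S.φ m s.2) (S.φ m w.2) (S.φ m t.2)
      have h4 := S.a_mul_le_abs_φ m w.1 t.1
      have h5 : (0 : ℝ) < |(w.1 : ℝ) - t.1| := by
        rw [abs_pos, sub_ne_zero]
        intro h
        exact hw1 (by rwa [show w.1 = t.1 by exact_mod_cast h])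
      have h6 := mul_pos ha h5
      have h7 := abs_nonneg (S.φ m w.1 - S.φ m s.1)
      simp only [Nat.succ_eq_add_one, Prod.mk.eta] at *
      linarith
    · have hst' : s.1 = t.1 + (S.p : ℤ) ^ (m + 1) ∨ t.1 = s.1 + (S.p : ℤ) ^ (m + 1) := by omega
      have hs1' : (S.p : ℤ) ^ (m + 1) ∣ s.1 := by
        rcases hs1 with h | h <;> rw [h]
        · exact hX
        · exact dvd_add hX dvd_rfl
      have h1 := abs_sub_le (S.φ m s.1) (S.φ m w.1) (S.φ m t.1)
      have h2 := abs_sub_le (S.φ m s.2) (S.φ m w.2) (S.φ m t.2)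
      have h3 := S.a_mul_le_abs_φ m s.2 t.2
      refine .inr ⟨?_, ?_⟩
      · rcases S.graph.stays_or_exits (InStrip ((S.p : ℤ) ^ (m + 1)) Y)
          (fun x t => |S.φ m x.1 - S.φ m t.1| + S.a * |(x.2 : ℝ) - t.2|) (fun t => by simp) hstrip
          p₂ hs2 with hall | ⟨z', s', h', q₀, q₂, hq, hq₀, hs', hc'⟩
        · intro x hx
          have hx' : x ∈ γ.reverse.support := by simpa using hx
          rw [hγ, SimpleGraph.Walk.mem_support_append_iff, SimpleGraph.Walk.support_cons,
            List.mem_cons] at hx'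
          rcases hx' with hx' | rfl | hx'
          · exact (hp₀ x hx').2
          · exact hz.2
          · exact hall x hx'
        · exfalso
          have h4 := S.dist_lt_of_crossing hY ht1 hst'.symm ht2
            (exit_strip (hq₀ z' (by simp)) hs' h')
          have h5 : S.graph.cost p₂ = S.graph.cost q₀ + S.wt h' + S.graph.cost q₂ := by
            rw [hq, WeightedGraph.cost_append, WeightedGraph.cost_cons]
            ring
          change _ ≤ S.graph.cost q₀ + S.wt h' at hc'
          have h6 := hd s' t
          have h7 := S.graph.dist_le_cost q₂
          rw [S.dist_comm] at h7
          have e3 := abs_sub_comm (S.φ m s.1) (S.φ m t.1)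
          have e4 := abs_sub_comm (s.2 : ℝ) t.2
          have e5 := S.dist_comm s' t
          rw [e3] at h1
          rw [e4] at h3
          linarith
      · rcases S.graph.stays_or_exits (InStrip ((S.p : ℤ) ^ (m + 1)) Y)
          (fun x t => |S.φ m x.1 - S.φ m t.1| + S.a * |(x.2 : ℝ) - t.2|) (fun t => by simp) hstrip
          δ ht2 with hall | ⟨z', t', h', q₀, q₂, hq, hq₀, ht', hc'⟩
        · exact hall
        · exfalso
          have h4 := S.dist_lt_of_crossing hY hs1' hst' hs2
            (exit_strip (hq₀ z' (by simp)) ht' h')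
          have h5 : S.graph.cost δ = S.graph.cost q₀ + S.wt h' + S.graph.cost q₂ := by
            rw [hq, WeightedGraph.cost_append, WeightedGraph.cost_cons]
            ring
          change _ ≤ S.graph.cost q₀ + S.wt h' at hc'
          have h6 := hd s t'
          have h7 := S.graph.dist_le_cost q₂
          linarith
  · exfalso
    -- Adjacent sides: the route round the corner uses potentials of level `m + 1`. It is strictly
    -- cheaper because a coordinate of `w` is divisible by `p ^ m` (`abs_pot_lt_abs_pot`).
    have hs1' : (S.p : ℤ) ^ (m + 1) ∣ s.2 := by
      rcases hs1 with h | h <;> rw [h]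
      · exact hY
      · exact dvd_add hY dvd_rfl
    have h1 := S.dist_horizontal_le hs1' s.1 t.1
    have h2 := S.dist_vertical_le ht1 s.2 t.2
    have h3 := S.dist_triangle s (t.1, s.2) t
    have h4 := abs_sub_le (S.φ (m + 1) s.1) (S.φ (m + 1) w.1) (S.φ (m + 1) t.1)
    have h5 := abs_sub_le (S.φ (m + 1) s.2) (S.φ (m + 1) w.2) (S.φ (m + 1) t.2)
    have h6 := S.abs_φ_mono (Nat.le_succ m) s.1 w.1
    have h7 := S.abs_φ_mono (Nat.le_succ m) w.1 t.1
    have h8 := S.abs_φ_mono (Nat.le_succ m) s.2 w.2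
    have h9 := S.abs_φ_mono (Nat.le_succ m) w.2 t.2
    simp only [Nat.succ_eq_add_one, Prod.mk.eta] at *
    rcases hwm with hwm | hwm
    · have : |S.φ (m + 1) w.1 - S.φ (m + 1) t.1| < |S.φ m w.1 - S.φ m t.1| :=
        abs_pot_lt_abs_pot S.odd S.three_le S.lt hwm hw1 ht1
      linarith
    · have : |S.φ (m + 1) w.2 - S.φ (m + 1) s.2| < |S.φ m w.2 - S.φ m s.2| :=
        abs_pot_lt_abs_pot S.odd S.three_le S.lt hwm hw2 hs1'
      rw [abs_sub_comm (S.φ (m + 1) s.2) (S.φ (m + 1) w.2)] at h5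
      linarith

end SlowFast

/-! ### Geodesics far from their ends: strip or grid. -/

theorem exists_strip_of_not_dvd {Q x : ℤ} (hQ : 0 < Q) (h : ¬ Q ∣ x) :
    ∃ X, Q ∣ X ∧ X < x ∧ x < X + Q := by
  refine ⟨Q * (x / Q), dvd_mul_right _ _, ?_, ?_⟩
  · refine lt_of_le_of_ne (Int.mul_ediv_self_le hQ.ne') fun h' => h ?_
    rw [← h']
    exact dvd_mul_right _ _
  · exact Int.lt_mul_ediv_self_add hQ

namespace SlowFast

variable (S : SlowFast)

theorem exists_coarser_strip {m n : ℕ} (h : m ≤ n) {Y : ℤ} (hY : (S.p : ℤ) ^ m ∣ Y) :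
    ∃ Y', (S.p : ℤ) ^ n ∣ Y' ∧ Y' ≤ Y ∧ Y + (S.p : ℤ) ^ m ≤ Y' + (S.p : ℤ) ^ n := by
  have hQ := S.pow_pos n
  refine ⟨(S.p : ℤ) ^ n * (Y / (S.p : ℤ) ^ n), dvd_mul_right _ _,
    Int.mul_ediv_self_le hQ.ne', ?_⟩
  have h1 : Y < (S.p : ℤ) ^ n * (Y / (S.p : ℤ) ^ n) + (S.p : ℤ) ^ n := Int.lt_mul_ediv_self_add hQ
  have h2 : (S.p : ℤ) ^ m ∣ (S.p : ℤ) ^ n * (Y / (S.p : ℤ) ^ n) + (S.p : ℤ) ^ n :=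
    dvd_add ((pow_dvd_pow _ h).trans (dvd_mul_right _ _)) (pow_dvd_pow _ h)
  have := Int.le_of_dvd (by linarith) (dvd_sub h2 hY)
  linarith

/-- Here `m` is the highest level of a line through the point, so its smallest open cell has level
`m + 1`. -/
theorem exists_level {n : ℕ} {x y : ℤ} (hx : ¬ (S.p : ℤ) ^ n ∣ x) (hy : ¬ (S.p : ℤ) ^ n ∣ y) :
    ∃ m, m + 1 ≤ n ∧ ¬ (S.p : ℤ) ^ (m + 1) ∣ x ∧ ¬ (S.p : ℤ) ^ (m + 1) ∣ y ∧
      ((S.p : ℤ) ^ m ∣ x ∨ (S.p : ℤ) ^ m ∣ y) := by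
  induction n with
  | zero => simp at hx
  | succ n ih =>
    by_cases h : (S.p : ℤ) ^ n ∣ x ∨ (S.p : ℤ) ^ n ∣ y
    · exact ⟨n, le_rfl, hx, hy, h⟩
    · rw [not_or] at h
      obtain ⟨m, h1, h2⟩ := ih h.1 h.2
      exact ⟨m, by omega, h2⟩

theorem pow_le_pow {m n : ℕ} (h : m ≤ n) : (S.p : ℤ) ^ m ≤ (S.p : ℤ) ^ n :=
  pow_le_pow_right₀ (by have := S.p_pos; omega) h

/-- The walk stays in an open horizontal strip of level `n`. -/
def HStripped (n : ℕ) {u v : ℤ × ℤ} (γ : squareLattice.Walk u v) : Prop :=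
  ∃ Y, (S.p : ℤ) ^ n ∣ Y ∧ ∀ z ∈ γ.support, InStrip ((S.p : ℤ) ^ n) Y z

/-- The walk stays in an open vertical strip of level `n`. -/
def VStripped (n : ℕ) {u v : ℤ × ℤ} (γ : squareLattice.Walk u v) : Prop :=
  ∃ Y, (S.p : ℤ) ^ n ∣ Y ∧ ∀ z ∈ γ.support, InStrip ((S.p : ℤ) ^ n) Y z.swap

/-- Both coordinates differ by less than `p ^ n`. -/
def Near (n : ℕ) (u w : ℤ × ℤ) : Prop :=
  |u.1 - w.1| < (S.p : ℤ) ^ n ∧ |u.2 - w.2| < (S.p : ℤ) ^ n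

/-- The vertex `w` lies on a vertical line of level `n`, and is farther from `u` than all
points above, or all points below it on its segment of level `n`. -/
def GoodV (n : ℕ) (u w : ℤ × ℤ) : Prop :=
  (S.p : ℤ) ^ n ∣ w.1 ∧
    ((∀ y < w.2, y / (S.p : ℤ) ^ n = w.2 / (S.p : ℤ) ^ n →
        S.graph.dist u (w.1, y) < S.graph.dist u w) ∨
      ∀ y > w.2, y / (S.p : ℤ) ^ n = w.2 / (S.p : ℤ) ^ n →
        S.graph.dist u (w.1, y) < S.graph.dist u w)

/-- The walk passes through a crossing of lines of level `n`. -/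
def MeetsGrid (n : ℕ) {u v : ℤ × ℤ} (γ : squareLattice.Walk u v) : Prop :=
  ∃ e ∈ γ.support, (S.p : ℤ) ^ n ∣ e.1 ∧ (S.p : ℤ) ^ n ∣ e.2

theorem hStripped_of_le {m n : ℕ} (h : m ≤ n) {u v : ℤ × ℤ} {γ : squareLattice.Walk u v} {Y : ℤ}
    (hY : (S.p : ℤ) ^ m ∣ Y) (hγ : ∀ z ∈ γ.support, InStrip ((S.p : ℤ) ^ m) Y z) :
    S.HStripped n γ := by
  obtain ⟨Y', h1, h2, h3⟩ := S.exists_coarser_strip h hY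
  refine ⟨Y', h1, fun z hz => ?_⟩
  have := hγ z hz
  unfold InStrip at *
  omega

theorem near_of_inCell {m n : ℕ} (h : m ≤ n) {X Y : ℤ} {u w : ℤ × ℤ}
    (hu : InCell ((S.p : ℤ) ^ m) X Y u) (hw : InCell ((S.p : ℤ) ^ m) X Y w) : S.Near n u w := by
  have := S.pow_le_pow h
  unfold InCell at *
  unfold Near
  rw [abs_lt, abs_lt]
  omega

theorem hStripped_map_swap {n : ℕ} {u v : ℤ × ℤ} {γ : squareLattice.Walk u v} :
    S.HStripped n (γ.map squareLatticeSwap) ↔ S.VStripped n γ := by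
  simp only [HStripped, VStripped, SimpleGraph.Walk.support_map, List.mem_map,
    forall_exists_index, and_imp, forall_apply_eq_imp_iff₂]
  rfl

/-- The smallest cell around `w` has level at most `n`, and neither end is in it. A forward exit
through a vertical side gives a horizontal strip by `inCell_or_inStrip`; an exit through a
horizontal side is its mirror image. -/
theorem stripped_of_not_dvd {n : ℕ} {u v w : ℤ × ℤ} (γ₁ : squareLattice.Walk u w)
    (γ₂ : squareLattice.Walk w v)
    (hgeo : S.graph.cost γ₁ + S.graph.cost γ₂ ≤ S.graph.dist u v)
    (hw1 : ¬ (S.p : ℤ) ^ n ∣ w.1) (hw2 : ¬ (S.p : ℤ) ^ n ∣ w.2)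
    (hu : ¬ S.Near n u w) (hv : ¬ S.Near n v w) :
    S.HStripped n (γ₁.append γ₂) ∨ S.VStripped n (γ₁.append γ₂) := by
  obtain ⟨m, hmn, h1, h2, h3⟩ := S.exists_level hw1 hw2
  obtain ⟨X, hX, hX'⟩ := exists_strip_of_not_dvd (S.pow_pos _) h1
  obtain ⟨Y, hY, hY'⟩ := exists_strip_of_not_dvd (S.pow_pos _) h2
  have hw : InCell ((S.p : ℤ) ^ (m + 1)) X Y w := ⟨hX', hY'⟩
  rcases S.graph.stays_or_exits (InCell ((S.p : ℤ) ^ (m + 1)) X Y)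
    (fun x t => |S.φ m x.1 - S.φ m t.1| + |S.φ m x.2 - S.φ m t.2|) (fun t => by simp)
    (fun x y h hx t => S.cell_lipschitz m h (not_dvd_of_lt_of_lt hX hx.1.1 hx.1.2)
      (not_dvd_of_lt_of_lt hY hx.2.1 hx.2.2) t) γ₂ hw with
    hall | ⟨z, t, h, p₀, p₂, rfl, hp₀, ht, hc⟩
  · exact absurd (S.near_of_inCell hmn (hall v (by simp)) hw) hv
  have hz : InCell ((S.p : ℤ) ^ (m + 1)) X Y z := hp₀ z (by simp)
  change _ ≤ S.graph.cost p₀ + S.wt h at hc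
  rw [WeightedGraph.cost_append, WeightedGraph.cost_cons] at hgeo
  have hgeo' : S.graph.cost γ₁ + (S.graph.cost p₀ + S.wt h) + S.graph.cost p₂ ≤
      S.graph.dist u v := by linarith
  rcases exit_cell hz ht h with ⟨ht1, ht2⟩ | ⟨ht1, ht2⟩
  · left
    rcases S.inCell_or_inStrip γ₁ p₂ _ hc hgeo' hX hY hw h3 ht1 ht2 with h' | ⟨h4, h5⟩
    · exact absurd (S.near_of_inCell hmn h' hw) hu
    · apply S.hStripped_of_le hmn hY
      intro x hx
      simp only [SimpleGraph.Walk.mem_support_append_iff, SimpleGraph.Walk.support_cons,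
        List.mem_cons] at hx
      rcases hx with hx | hx | rfl | hx
      · exact h4 x hx
      · exact (hp₀ x hx).2
      · exact hz.2
      · exact h5 x hx
  · right
    rw [← hStripped_map_swap]
    rcases S.inCell_or_inStrip (γ₁.map squareLatticeSwap) (p₂.map squareLatticeSwap)
      (S.graph.cost p₀ + S.wt h) (by rw [add_comm]; exact hc)
      (by rw [S.cost_swap, S.cost_swap]; exact hgeo'.trans_eq (S.dist_swap u v).symm) hY hX
      ⟨hw.2, hw.1⟩ h3.symm ht1 ht2 with h' | ⟨h4, h5⟩
    · exact absurd (S.near_of_inCell hmn ⟨h'.2, h'.1⟩ hw) hu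
    · apply S.hStripped_of_le hmn hX
      intro x hx
      simp only [SimpleGraph.Walk.support_map, List.mem_map, SimpleGraph.Walk.mem_support_append_iff,
        SimpleGraph.Walk.support_cons, List.mem_cons] at hx h4 h5
      obtain ⟨x, hx | hx | rfl | hx, rfl⟩ := hx
      · exact h4 _ ⟨x, hx, rfl⟩
      · exact (hp₀ x hx).1
      · exact hz.1
      · exact h5 _ ⟨x, hx, rfl⟩

theorem dist_lt_of_mem_support {u w z : ℤ × ℤ} (γ : squareLattice.Walk u w)
    (hγ : S.graph.cost γ ≤ S.graph.dist u w) (hz : z ∈ γ.support) (hzw : z ≠ w) :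
    S.graph.dist u z < S.graph.dist u w := by
  obtain ⟨p, q, -, h⟩ := S.graph.cost_split γ hz
  have h1 := S.graph.dist_le_cost p
  have h2 := S.graph.dist_le_cost q
  have h3 := S.le_dist z w
  have h4 : 0 < |(z.1 : ℝ) - w.1| + |(z.2 : ℝ) - w.2| := by
    by_contra! hh
    have h5 := abs_nonneg ((z.1 : ℝ) - w.1)
    have h6 := abs_nonneg ((z.2 : ℝ) - w.2)
    have h7 : |(z.1 : ℝ) - w.1| = 0 := by linarith
    have h8 : |(z.2 : ℝ) - w.2| = 0 := by linarith
    rw [abs_eq_zero, sub_eq_zero] at h7 h8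
    exact hzw (Prod.ext (by exact_mod_cast h7) (by exact_mod_cast h8))
  have := mul_pos S.a_pos' h4
  linarith

/-- Follow the geodesic from `w` back towards `u` along the open segment of its column. If it leaves
at an end of the segment, this end is a crossing and the points passed on the way are strictly
closer to `u`. If it leaves sideways, it is in a cell with that column as a side, and
`inCell_or_inStrip` applies. -/
theorem hStripped_or_goodV {n : ℕ} {u v w : ℤ × ℤ} (γ₁ : squareLattice.Walk u w)
    (γ₂ : squareLattice.Walk w v)
    (hgeo : S.graph.cost γ₁ + S.graph.cost γ₂ ≤ S.graph.dist u v)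
    (hw1 : (S.p : ℤ) ^ n ∣ w.1) (hu : ¬ S.Near n u w) :
    S.HStripped n (γ₁.append γ₂) ∨ (S.GoodV n u w ∧ S.MeetsGrid n (γ₁.append γ₂)) := by
  have hq := S.pow_pos n
  by_cases hw2 : (S.p : ℤ) ^ n ∣ w.2
  -- At a crossing the condition is vacuous: `w` is the lowest point of its half-open segment.
  · refine .inr ⟨⟨hw1, .inl fun y hy h => ?_⟩, w, by simp, hw1, hw2⟩
    have h1 := Int.mul_ediv_self_le (x := y) hq.ne'
    rw [h, Int.mul_ediv_cancel' hw2] at h1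
    have h2 : w.2 / (S.p : ℤ) ^ n * (S.p : ℤ) ^ n ≤ y := by
      rw [← h]
      exact Int.ediv_mul_le y hq.ne'
    rw [Int.ediv_mul_cancel hw2] at h2
    omega
  have hγ₁ : S.graph.cost γ₁ ≤ S.graph.dist u w := by
    have h1 := S.dist_triangle u w v
    have h2 := S.graph.dist_le_cost γ₂
    linarith
  obtain ⟨Y, hY, hYw⟩ := exists_strip_of_not_dvd hq hw2
  have hfloor : ∀ y, y / (S.p : ℤ) ^ n = w.2 / (S.p : ℤ) ^ n →
      Y ≤ y ∧ y < Y + (S.p : ℤ) ^ n := by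
    obtain ⟨k, rfl⟩ := hY
    intro y hy
    have hk : w.2 / (S.p : ℤ) ^ n = k := by
      rw [Int.ediv_eq_iff_of_pos hq]
      constructor <;> linarith
    rw [hk, Int.ediv_eq_iff_of_pos hq] at hy
    constructor <;> linarith
  -- Only the decomposition of the walk is needed, so the cost bound is taken to be `0`.
  rcases S.graph.stays_or_exits (fun z => z.1 = w.1 ∧ InStrip ((S.p : ℤ) ^ n) Y z)
    (fun _ _ => 0) (fun _ => le_rfl)
    (fun x y h _ _ => by simpa using (S.graph.weight_pos _).le) γ₁.reverse ⟨rfl, hYw⟩ with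
    hall | ⟨z, t, h, p₀, p₂, hγ, hp₀, ht, -⟩
  · refine absurd ?_ hu
    have := hall u (by simp)
    unfold InStrip at this
    unfold Near
    rw [abs_lt, abs_lt]
    omega
  have hz := hp₀ z (by simp)
  have hmem : ∀ x, x ∈ γ₁.support ↔ x ∈ p₀.support ∨ x = z ∨ x ∈ p₂.support := fun x => by
    have : x ∈ γ₁.support ↔ x ∈ γ₁.reverse.support := by simp
    rw [this, hγ]
    simp
  have hadj := squareLattice_adj_iff.1 h
  unfold InStrip at *
  by_cases htz : t.1 = z.1
  · right
    have htY : t.2 = Y ∨ t.2 = Y + (S.p : ℤ) ^ n := by omega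
    have htm : t ∈ γ₁.support := (hmem t).2 (.inr (.inr (by simp)))
    have hlt : ∀ y, y ≠ w.2 → (w.2 ≤ y ∧ y ≤ t.2 ∨ t.2 ≤ y ∧ y ≤ w.2) →
        S.graph.dist u (w.1, y) < S.graph.dist u w := by
      intro y hy hyt
      obtain ⟨x, hx, rfl⟩ := (p₀.append (.cons h .nil)).exists_mem_support_eq (fun z => z.2)
        (fun x y hxy => by
          have := squareLattice_adj_iff.1 hxy
          rw [abs_le]
          omega) y hyt
      have hx1 : x.1 = w.1 ∧ x ∈ γ₁.support := by
        simp only [SimpleGraph.Walk.mem_support_append_iff, SimpleGraph.Walk.support_cons,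
          SimpleGraph.Walk.support_nil, List.mem_cons, List.not_mem_nil, or_false] at hx
        rcases hx with hx | rfl | rfl
        · exact ⟨(hp₀ x hx).1, (hmem x).2 (.inl hx)⟩
        · exact ⟨hz.1, (hmem x).2 (.inr (.inl rfl))⟩
        · exact ⟨htz.trans hz.1, htm⟩
      refine S.dist_lt_of_mem_support γ₁ hγ₁ (z := (w.1, x.2)) ?_ ?_
      · rw [← hx1.1]
        exact hx1.2
      · intro h'
        have := congrArg Prod.snd h'
        exact hy this
    refine ⟨⟨hw1, ?_⟩, t, ?_, ?_, ?_⟩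
    · rcases htY with htY | htY
      · refine .inl fun y hy hyf => hlt y hy.ne (.inr ⟨?_, hy.le⟩)
        have := hfloor y hyf
        omega
      · refine .inr fun y hy hyf => hlt y (ne_of_gt hy) (.inl ⟨le_of_lt hy, ?_⟩)
        have := hfloor y hyf
        omega
    · rw [SimpleGraph.Walk.mem_support_append_iff]
      exact .inl htm
    · rwa [htz, hz.1]
    · rcases htY with h' | h' <;> rw [h']
      · exact hY
      · exact dvd_add hY dvd_rfl
  · left
    -- The sideways exit. As `t` is one step from a column of level `n`, that column bounds the
    -- smallest cell of `t`.
    have ht2 : t.2 = z.2 := by omega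
    have hn : n ≠ 0 := by
      rintro rfl
      simp at hw2
    have hp3 : (3 : ℤ) ≤ S.p := by exact_mod_cast S.three_le
    have ht1n : ¬ (S.p : ℤ) ^ n ∣ t.1 := by
      intro h'
      have h1 : (S.p : ℤ) ^ n ∣ t.1 - z.1 := dvd_sub h' (hz.1 ▸ hw1)
      have h2 : (S.p : ℤ) ∣ t.1 - z.1 := (dvd_pow_self _ hn).trans h1
      rcases hadj with ⟨-, h3 | h3⟩ | ⟨h3, -⟩
      · rw [h3, show z.1 + 1 - z.1 = 1 by ring] at h2
        have := Int.le_of_dvd one_pos h2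
        omega
      · rw [h3, show z.1 - 1 - z.1 = -1 by ring, dvd_neg] at h2
        have := Int.le_of_dvd one_pos h2
        omega
      · exact htz h3
    have ht2n : ¬ (S.p : ℤ) ^ n ∣ t.2 := ht2 ▸ not_dvd_of_lt_of_lt hY hz.2.1 hz.2.2
    obtain ⟨m, hmn, h1, h2, h3⟩ := S.exists_level ht1n ht2n
    obtain ⟨Y', hY', hYt⟩ := exists_strip_of_not_dvd (S.pow_pos _) h2
    have hQ : (3 : ℤ) ≤ (S.p : ℤ) ^ (m + 1) :=
      hp3.trans (by simpa using S.pow_le_pow (Nat.succ_le_succ (Nat.zero_le m)))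
    have hzm : (S.p : ℤ) ^ (m + 1) ∣ z.1 := (pow_dvd_pow _ hmn).trans (hz.1 ▸ hw1)
    obtain ⟨X, hX, hXt, hXz⟩ : ∃ X, (S.p : ℤ) ^ (m + 1) ∣ X ∧
        (X < t.1 ∧ t.1 < X + (S.p : ℤ) ^ (m + 1)) ∧
        (z.1 = X ∨ z.1 = X + (S.p : ℤ) ^ (m + 1)) := by
      rcases hadj with ⟨-, h3 | h3⟩ | ⟨h3, -⟩
      · exact ⟨z.1, hzm, by omega, .inl rfl⟩
      · exact ⟨z.1 - (S.p : ℤ) ^ (m + 1), dvd_sub hzm dvd_rfl, by omega, .inr (by omega)⟩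
      · exact absurd h3 htz
    have hK : |S.φ m t.1 - S.φ m z.1| + |S.φ m t.2 - S.φ m z.2| ≤ S.wt h.symm := by
      have := (S.wt_horizontal' h.symm ht2.symm m).1 h2
      rw [ht2, sub_self, abs_zero, add_zero]
      exact this
    have hcost : S.graph.cost γ₁ = S.graph.cost p₀ + S.wt h + S.graph.cost p₂ := by
      rw [← WeightedGraph.cost_reverse, hγ, WeightedGraph.cost_append, WeightedGraph.cost_cons]
      ring
    -- The geodesic is read as `u → t → z → w → v`: `t` is the vertex in the cell, and the edge to
    -- `z` is the exit.
    rcases S.inCell_or_inStrip p₂.reverse (p₀.reverse.append γ₂) (S.wt h.symm) hK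
      (by
        rw [S.wt_symm h, WeightedGraph.cost_append, WeightedGraph.cost_reverse,
          WeightedGraph.cost_reverse]
        linarith) hX hY' ⟨hXt, hYt⟩ h3 hXz (by unfold InStrip; omega) with h' | ⟨h4, h5⟩
    · refine absurd ?_ hu
      obtain ⟨Y'', hY'', h4, h5⟩ := S.exists_coarser_strip hmn hY'
      have h6 := S.pow_le_pow hmn
      unfold InCell at h'
      have h7 : Y'' = Y := by
        obtain ⟨i, rfl⟩ := hY''
        obtain ⟨j, rfl⟩ := hY
        have h8 : (S.p : ℤ) ^ n * i < (S.p : ℤ) ^ n * (j + 1) := by linarith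
        have h9 : (S.p : ℤ) ^ n * j < (S.p : ℤ) ^ n * (i + 1) := by linarith
        have h8 := lt_of_mul_lt_mul_left h8 hq.le
        have h9 := lt_of_mul_lt_mul_left h9 hq.le
        rw [show i = j by omega]
      unfold Near
      rw [abs_lt, abs_lt]
      omega
    · apply S.hStripped_of_le hmn hY'
      intro x hx
      rw [SimpleGraph.Walk.mem_support_append_iff] at hx
      have h6 : z ∈ (p₀.reverse.append γ₂).support := by simp
      rcases hx with hx | hx
      · rcases (hmem x).1 hx with hx | rfl | hx
        · exact h5 x (by simp [hx])
        · exact h5 x h6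
        · exact h4 x (by simpa using hx)
      · exact h5 x (by simp [hx])

/-- The vertices of a geodesic far from its ends: the geodesic stays in a strip, or the vertex is on
the grid and the geodesic reaches it along the grid. -/
theorem stripped_or_good {n : ℕ} {u v w : ℤ × ℤ} (γ : squareLattice.Walk u v)
    (hγ : S.graph.IsGeodesic γ) (hw : w ∈ γ.support) (hu : ¬ S.Near n u w)
    (hv : ¬ S.Near n v w) :
    S.HStripped n γ ∨ S.VStripped n γ ∨
      (S.GoodV n u w ∨ S.GoodV n u.swap w.swap) ∧ S.MeetsGrid n γ := by
  obtain ⟨γ₁, γ₂, rfl, hcost⟩ := S.graph.cost_split γ hw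
  have hgeo : S.graph.cost γ₁ + S.graph.cost γ₂ ≤ S.graph.dist u v := by
    rw [← hcost]
    exact hγ.le
  by_cases h1 : (S.p : ℤ) ^ n ∣ w.1
  · rcases S.hStripped_or_goodV γ₁ γ₂ hgeo h1 hu with h | h
    · exact .inl h
    · exact .inr (.inr ⟨.inl h.1, h.2⟩)
  by_cases h2 : (S.p : ℤ) ^ n ∣ w.2
  · rcases S.hStripped_or_goodV (γ₁.map squareLatticeSwap) (γ₂.map squareLatticeSwap)
      (by rw [S.cost_swap, S.cost_swap]; exact hgeo.trans_eq (S.dist_swap u v).symm) h2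
      (fun h => hu ⟨h.2, h.1⟩) with h | ⟨h3, e, he, he1, he2⟩
    · rw [← SimpleGraph.Walk.map_append, hStripped_map_swap] at h
      exact .inr (.inl h)
    · refine .inr (.inr ⟨.inr h3, ?_⟩)
      rw [← SimpleGraph.Walk.map_append, SimpleGraph.Walk.support_map, List.mem_map] at he
      obtain ⟨e, he, rfl⟩ := he
      exact ⟨e, he, he2, he1⟩
  · rcases S.stripped_of_not_dvd γ₁ γ₂ hgeo h1 h2 hu hv with h | h
    · exact .inl h
    · exact .inr (.inl h)

end SlowFast

/-! ### Counting the vertices of a slice level by level. -/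

/-- The set is finite with at most `x` elements. -/
def CardLE {α : Type*} (A : Set α) (x : ℝ) : Prop := A.Finite ∧ (A.ncard : ℝ) ≤ x

namespace CardLE

variable {α β : Type*} {A B : Set α} {x y : ℝ}

theorem empty (hx : 0 ≤ x) : CardLE (∅ : Set α) x := ⟨Set.finite_empty, by simpa using hx⟩

theorem mono (hB : CardLE B x) (h : A ⊆ B) (hxy : x ≤ y) : CardLE A y := by
  refine ⟨hB.1.subset h, le_trans ?_ (hB.2.trans hxy)⟩
  exact_mod_cast Set.ncard_le_ncard h hB.1

theorem union (hA : CardLE A x) (hB : CardLE B y) : CardLE (A ∪ B) (x + y) := by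
  refine ⟨hA.1.union hB.1, ?_⟩
  have : ((A ∪ B).ncard : ℝ) ≤ A.ncard + B.ncard := by exact_mod_cast Set.ncard_union_le A B
  linarith [hA.2, hB.2]

theorem biUnion {ι : Type*} (U : Finset ι) (F : ι → Set α) (h : ∀ i ∈ U, CardLE (F i) x) :
    CardLE (⋃ i ∈ U, F i) (U.card * x) := by
  classical
  induction U using Finset.induction_on with
  | empty => simpa using CardLE.empty le_rfl
  | insert i U hi ih =>
    have h1 := (h i (by simp)).union (ih fun j hj => h j (by simp [hj]))
    rw [Finset.set_biUnion_insert, Finset.card_insert_of_notMem hi]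
    exact h1.mono subset_rfl (by push_cast; linarith)

theorem of_injOn (f : α → β) (T : Finset β) (hf : ∀ a ∈ A, f a ∈ T) (hinj : Set.InjOn f A) :
    CardLE A T.card := by
  have hfin : A.Finite :=
    Set.Finite.of_injOn (t := (T : Set β)) (fun a ha => hf a ha) hinj T.finite_toSet
  refine ⟨hfin, ?_⟩
  have := Set.ncard_le_ncard_of_injOn (t := (T : Set β)) f (fun a ha => hf a ha) hinj
    T.finite_toSet
  rw [Set.ncard_coe_finset] at this
  exact_mod_cast this

theorem of_image {f : α → β} (hf : Function.Injective f) (h : CardLE (f '' A) x) : CardLE A x :=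
  ⟨h.1.of_finite_image hf.injOn, by rw [← Set.ncard_image_of_injective A hf]; exact h.2⟩

end CardLE

theorem card_Icc_ediv_le {q l h : ℤ} (hq : 0 < q) (hlh : l ≤ h) :
    ((Finset.Icc (l / q) (h / q)).card : ℝ) ≤ ((h : ℝ) - l) / q + 2 := by
  have h1 : l / q ≤ h / q := Int.ediv_le_ediv hq hlh
  have h2 : ((Finset.Icc (l / q) (h / q)).card : ℤ) = h / q + 1 - l / q := by
    rw [Int.card_Icc, Int.toNat_of_nonneg (by omega)]
  have h3 : ((Finset.Icc (l / q) (h / q)).card : ℝ) = (h / q : ℤ) + 1 - (l / q : ℤ) := by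
    exact_mod_cast h2
  have hq' : (0 : ℝ) < q := by exact_mod_cast hq
  have h4 : ((q * (h / q) : ℤ) : ℝ) ≤ h := by exact_mod_cast Int.mul_ediv_self_le hq.ne'
  have h5 : (l : ℝ) < ((q * (l / q) + q : ℤ) : ℝ) := by
    exact_mod_cast Int.lt_mul_ediv_self_add hq
  push_cast at h4 h5
  rw [h3, ← sub_le_iff_le_add, le_div_iff₀ hq']
  nlinarith

theorem card_window_le {q c : ℤ} {R : ℝ} (hq : 0 < q) (hR : 0 ≤ R) :
    ((Finset.Icc ((c - ⌊R⌋) / q) ((c + ⌊R⌋) / q)).card : ℝ) ≤ 2 * R / q + 2 := by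
  have h0 : 0 ≤ ⌊R⌋ := Int.floor_nonneg.2 hR
  have h1 := card_Icc_ediv_le (q := q) (l := c - ⌊R⌋) (h := c + ⌊R⌋) hq (by omega)
  have hq' : (0 : ℝ) < q := by exact_mod_cast hq
  have h2 : (((c + ⌊R⌋ : ℤ) : ℝ) - ((c - ⌊R⌋ : ℤ) : ℝ)) / q ≤ 2 * R / q := by
    have := Int.floor_le R
    apply div_le_div_of_nonneg_right _ hq'.le
    push_cast
    linarith
  linarith

theorem ediv_mem_window {q c x : ℤ} {R : ℝ} (hq : 0 < q) (h : |(x : ℝ) - c| ≤ R) :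
    x / q ∈ Finset.Icc ((c - ⌊R⌋) / q) ((c + ⌊R⌋) / q) := by
  have h1 : |x - c| ≤ ⌊R⌋ := Int.le_floor.2 (by exact_mod_cast h)
  rw [abs_le] at h1
  rw [Finset.mem_Icc]
  exact ⟨Int.ediv_le_ediv hq (by omega), Int.ediv_le_ediv hq (by omega)⟩

theorem strip_unique {Q Y Y' y : ℤ} (hY : Q ∣ Y) (hY' : Q ∣ Y') (h1 : Y < y) (h2 : y < Y + Q)
    (h3 : Y' < y) (h4 : y < Y' + Q) : Y = Y' := by
  have hQ : 0 < Q := by omega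
  by_contra hne
  rcases lt_or_gt_of_ne hne with h | h
  · have := Int.le_of_dvd (by omega) (dvd_sub hY' hY)
    omega
  · have := Int.le_of_dvd (by omega) (dvd_sub hY hY')
    omega

namespace SlowFast

variable (S : SlowFast)

/-- Of two vertices at the same distance on one segment, the upper one cannot be farther than
everything below it, nor the lower one farther than everything above it. Each of the two
alternatives thus allows one vertex per segment. -/
theorem cardLE_goodV {n : ℕ} {u : ℤ × ℤ} {r : ℝ} {A : Set (ℤ × ℤ)}
    (hA : ∀ w ∈ A, S.graph.dist u w = r ∧ S.GoodV n u w) (I J : Finset ℤ)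
    (hI : ∀ w ∈ A, w.1 / (S.p : ℤ) ^ n ∈ I) (hJ : ∀ w ∈ A, w.2 / (S.p : ℤ) ^ n ∈ J) :
    CardLE A (2 * (I.card * J.card)) := by
  have hmaps : ∀ w ∈ A, (w.1 / (S.p : ℤ) ^ n, w.2 / (S.p : ℤ) ^ n) ∈ I ×ˢ J := fun w hw =>
    Finset.mem_product.2 ⟨hI w hw, hJ w hw⟩
  have hfst : ∀ w w' : ℤ × ℤ, w ∈ A → w' ∈ A →
      w.1 / (S.p : ℤ) ^ n = w'.1 / (S.p : ℤ) ^ n → w.1 = w'.1 := by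
    intro w w' hw hw' h
    rw [← Int.ediv_mul_cancel (hA w hw).2.1, ← Int.ediv_mul_cancel (hA w' hw').2.1, h]
  have hlow : CardLE {w ∈ A | ∀ y < w.2, y / (S.p : ℤ) ^ n = w.2 / (S.p : ℤ) ^ n →
      S.graph.dist u (w.1, y) < S.graph.dist u w} (I ×ˢ J).card := by
    refine CardLE.of_injOn (fun w => (w.1 / (S.p : ℤ) ^ n, w.2 / (S.p : ℤ) ^ n)) _
      (fun w hw => hmaps w hw.1) ?_
    rintro w ⟨hw, hlw⟩ w' ⟨hw', hlw'⟩ heq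
    simp only [Prod.mk.injEq] at heq
    have h1 := hfst w w' hw hw' heq.1
    rcases lt_trichotomy w.2 w'.2 with h | h | h
    · have := hlw' _ h heq.2
      rw [← h1, Prod.mk.eta, (hA w hw).1, (hA w' hw').1] at this
      exact absurd this (lt_irrefl _)
    · exact Prod.ext h1 h
    · have := hlw _ h heq.2.symm
      rw [h1, Prod.mk.eta, (hA w hw).1, (hA w' hw').1] at this
      exact absurd this (lt_irrefl _)
  have hhigh : CardLE {w ∈ A | ∀ y > w.2, y / (S.p : ℤ) ^ n = w.2 / (S.p : ℤ) ^ n →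
      S.graph.dist u (w.1, y) < S.graph.dist u w} (I ×ˢ J).card := by
    refine CardLE.of_injOn (fun w => (w.1 / (S.p : ℤ) ^ n, w.2 / (S.p : ℤ) ^ n)) _
      (fun w hw => hmaps w hw.1) ?_
    rintro w ⟨hw, hlw⟩ w' ⟨hw', hlw'⟩ heq
    simp only [Prod.mk.injEq] at heq
    have h1 := hfst w w' hw hw' heq.1
    rcases lt_trichotomy w.2 w'.2 with h | h | h
    · have := hlw _ h heq.2.symm
      rw [h1, Prod.mk.eta, (hA w hw).1, (hA w' hw').1] at this
      exact absurd this (lt_irrefl _)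
    · exact Prod.ext h1 h
    · have := hlw' _ h heq.2
      rw [← h1, Prod.mk.eta, (hA w hw).1, (hA w' hw').1] at this
      exact absurd this (lt_irrefl _)
  refine (hlow.union hhigh).mono (fun w hw => ?_) ?_
  · exact (hA w hw).2.2.imp (fun h => ⟨hw, h⟩) (fun h => ⟨hw, h⟩)
  · rw [Finset.card_product]
    push_cast
    linarith

/-- The vertices at distance `r` reached along the grid of level `n`: at most four in each square. -/
theorem cardLE_good {n : ℕ} {u : ℤ × ℤ} {r : ℝ} {A : Set (ℤ × ℤ)}
    (hA : ∀ w ∈ A, S.graph.dist u w = r ∧ (S.GoodV n u w ∨ S.GoodV n u.swap w.swap))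
    (I J : Finset ℤ) (hI : ∀ w ∈ A, w.1 / (S.p : ℤ) ^ n ∈ I)
    (hJ : ∀ w ∈ A, w.2 / (S.p : ℤ) ^ n ∈ J) :
    CardLE A (4 * (I.card * J.card)) := by
  have h1 : CardLE {w ∈ A | S.GoodV n u w} (2 * (I.card * J.card)) :=
    S.cardLE_goodV (fun w hw => ⟨(hA w hw.1).1, hw.2⟩) I J (fun w hw => hI w hw.1)
      fun w hw => hJ w hw.1
  have h2 : CardLE {w ∈ A | S.GoodV n u.swap w.swap} (2 * (J.card * I.card)) := by
    refine CardLE.of_image Prod.swap_injective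
      (S.cardLE_goodV (n := n) (u := u.swap) (r := r) ?_ J I ?_ ?_)
    · rintro _ ⟨w, hw, rfl⟩
      exact ⟨(S.dist_swap u w).trans (hA w hw.1).1, hw.2⟩
    · rintro _ ⟨w, hw, rfl⟩
      exact hJ w hw.1
    · rintro _ ⟨w, hw, rfl⟩
      exact hI w hw.1
  refine (h1.union h2).mono (fun w hw => ?_) (le_of_eq (by ring))
  exact (hA w hw).2.imp (fun h => ⟨hw, h⟩) (fun h => ⟨hw, h⟩)

/-- The vertices at distance `r` from `u` that are reached along the grid of level `m`, on geodesics
staying in a horizontal strip of level `m + 1`. -/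
def stripSlice (m : ℕ) (u v : ℤ × ℤ) (r : ℝ) : Set (ℤ × ℤ) :=
  {w | S.graph.dist u w = r ∧ (S.GoodV m u w ∨ S.GoodV m u.swap w.swap) ∧
    ∃ γ : squareLattice.Walk u v, S.graph.IsGeodesic γ ∧ w ∈ γ.support ∧
      S.HStripped (m + 1) γ ∧ S.MeetsGrid m γ}

/-- On its way to `w₂` the second geodesic meets the column of `w₁`, at height within `p ^ (m + 1)`
of `w₁` since both lie in the strip of `u`. It has then spent at least `r - b * p ^ (m + 1)`, which
limits the remaining way to `w₂`. -/
theorem spread_le {m : ℕ} {u v w₁ w₂ : ℤ × ℤ} {r : ℝ} (h₁ : w₁ ∈ S.stripSlice m u v r)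
    (h₂ : w₂ ∈ S.stripSlice m u v r)
    (h : u.1 ≤ w₁.1 ∧ w₁.1 ≤ w₂.1 ∨ w₂.1 ≤ w₁.1 ∧ w₁.1 ≤ u.1) :
    S.a * |(w₁.1 : ℝ) - w₂.1| ≤ S.b * (S.p : ℝ) ^ (m + 1) := by
  obtain ⟨hr₁, -, γ₁, hγ₁, hw₁, ⟨Y₁, hY₁, hs₁⟩, -⟩ := h₁
  obtain ⟨hr₂, -, γ₂, hγ₂, hw₂, ⟨Y₂, hY₂, hs₂⟩, -⟩ := h₂
  obtain ⟨p, q, hpq, hcost⟩ := S.graph.cost_split γ₂ hw₂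
  have hp : S.graph.cost p ≤ r := by
    have h1 := S.dist_triangle u w₂ v
    have h2 := S.graph.dist_le_cost q
    have h3 : S.graph.cost γ₂ = S.graph.dist u v := hγ₂
    linarith
  obtain ⟨z, hz, hz1⟩ := p.exists_mem_support_eq (fun z => z.1)
    (fun x y hxy => by
      have := squareLattice_adj_iff.1 hxy
      rw [abs_le]
      omega) w₁.1 h
  have hzs : InStrip ((S.p : ℤ) ^ (m + 1)) Y₂ z := hs₂ z (by
    rw [hpq, SimpleGraph.Walk.mem_support_append_iff]
    exact .inl hz)
  have hws := hs₁ w₁ hw₁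
  have hu₁ := hs₁ u (by simp)
  have hu₂ := hs₂ u (by simp)
  have hYY := strip_unique hY₁ hY₂ hu₁.1 hu₁.2 hu₂.1 hu₂.2
  subst hYY
  have h1 : |(z.2 : ℝ) - w₁.2| < ((S.p ^ (m + 1) : ℤ) : ℝ) :=
    abs_sub_lt_of_lt hzs.1 hzs.2 hws.1 hws.2
  obtain ⟨p₁, p₂, -, hc⟩ := S.graph.cost_split p hz
  have h2 := S.graph.dist_le_cost p₁
  have h3 := S.graph.dist_le_cost p₂
  have h4 := S.le_dist z w₂
  have h5 := S.dist_le z w₁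
  have h6 := S.dist_triangle u z w₁
  have hb : (0 : ℝ) < S.b := S.a_pos'.trans S.lt'
  have h7 := mul_lt_mul_of_pos_left h1 hb
  have h8 := mul_nonneg S.a_pos'.le (abs_nonneg ((z.2 : ℝ) - w₂.2))
  rw [show z.1 = w₁.1 from hz1] at h4 h5
  rw [sub_self, abs_zero, zero_add] at h5
  push_cast at h7
  linarith

/-- The strip has `p` rows of cells of level `m`, and `spread_le` bounds the columns on each side of
`u`. Four vertices per cell and two sides give the factor `8`. -/
theorem cardLE_stripSlice (m : ℕ) (u v : ℤ × ℤ) (r : ℝ) :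
    CardLE (S.stripSlice m u v r)
      (8 * (S.p * (2 * ((S.b : ℝ) / S.a * S.p) + 2))) := by
  have ha := S.a_pos'
  have hb : (0 : ℝ) < S.b := ha.trans S.lt'
  have hp : (0 : ℝ) < S.p := by exact_mod_cast S.p_pos
  have hq := S.pow_pos m
  have hβ : (0 : ℝ) ≤ 2 * ((S.b : ℝ) / S.a * S.p) + 2 := by positivity
  rcases (S.stripSlice m u v r).eq_empty_or_nonempty with h0 | ⟨w₀, h₀⟩
  · rw [h0]
    exact CardLE.empty (by positivity)
  obtain ⟨γ₀, -, -, ⟨Y, hY, hs₀⟩, -⟩ := h₀.2.2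
  have hu₀ := hs₀ u (by simp)
  obtain ⟨j, rfl⟩ := hY
  -- All these geodesics start at `u`, so they share one strip.
  have hJ : ∀ w ∈ S.stripSlice m u v r, w.2 / (S.p : ℤ) ^ m ∈
      Finset.Ico (S.p * j) (S.p * j + S.p) := by
    rintro w ⟨-, -, γ, -, hw, ⟨Y', hY', hs⟩, -⟩
    have hu := hs u (by simp)
    have hYY := strip_unique (dvd_mul_right _ _) hY' hu₀.1 hu₀.2 hu.1 hu.2
    subst hYY
    obtain ⟨h1, h2⟩ := hs w hw
    rw [Finset.mem_Ico, Int.le_ediv_iff_mul_le hq, Int.ediv_lt_iff_lt_mul hq]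
    rw [pow_succ] at h1 h2
    constructor <;> linarith
  have hJcard : (Finset.Ico ((S.p : ℤ) * j) (S.p * j + S.p)).card = S.p := by simp
  have side : ∀ A ⊆ S.stripSlice m u v r, (∀ w₁ ∈ A, ∀ w₂ ∈ A,
      S.a * |(w₁.1 : ℝ) - w₂.1| ≤ S.b * (S.p : ℝ) ^ (m + 1)) →
      CardLE A (4 * (S.p * (2 * ((S.b : ℝ) / S.a * S.p) + 2))) := by
    intro A hA hspread
    rcases A.eq_empty_or_nonempty with rfl | ⟨w₁, hw₁⟩
    · exact CardLE.empty (by positivity)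
    set R : ℝ := S.b * (S.p : ℝ) ^ (m + 1) / S.a with hR
    have hR0 : 0 ≤ R := by positivity
    refine (S.cardLE_good (n := m) (u := u) (r := r) (fun w hw => ⟨(hA hw).1, (hA hw).2.1⟩)
      (Finset.Icc ((w₁.1 - ⌊R⌋) / (S.p : ℤ) ^ m) ((w₁.1 + ⌊R⌋) / (S.p : ℤ) ^ m)) _
      (fun w hw => ediv_mem_window hq ?_) (fun w hw => hJ w (hA hw))).mono subset_rfl ?_
    · rw [hR, le_div_iff₀ ha, mul_comm]
      exact hspread w hw w₁ hw₁
    · rw [hJcard]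
      have h1 := card_window_le (c := w₁.1) hq hR0
      have h2 : 2 * R / ((S.p ^ m : ℤ) : ℝ) = 2 * ((S.b : ℝ) / S.a * S.p) := by
        rw [hR]
        push_cast
        field_simp
        ring
      rw [h2] at h1
      have := mul_le_mul_of_nonneg_right h1 hp.le
      linarith
  have h1 := side {w ∈ S.stripSlice m u v r | u.1 ≤ w.1} (fun w hw => hw.1) (by
    intro w₁ hw₁ w₂ hw₂
    rcases le_total w₁.1 w₂.1 with h | h
    · exact S.spread_le hw₁.1 hw₂.1 (.inl ⟨hw₁.2, h⟩)
    · rw [abs_sub_comm]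
      exact S.spread_le hw₂.1 hw₁.1 (.inl ⟨hw₂.2, h⟩))
  have h2 := side {w ∈ S.stripSlice m u v r | w.1 ≤ u.1} (fun w hw => hw.1) (by
    intro w₁ hw₁ w₂ hw₂
    rcases le_total w₂.1 w₁.1 with h | h
    · exact S.spread_le hw₁.1 hw₂.1 (.inr ⟨h, hw₁.2⟩)
    · rw [abs_sub_comm]
      exact S.spread_le hw₂.1 hw₁.1 (.inr ⟨h, hw₂.2⟩))
  refine (h1.union h2).mono (fun w hw => ?_) (le_of_eq (by ring))
  exact (le_total u.1 w.1).imp (fun h => ⟨hw, h⟩) (fun h => ⟨hw, h⟩)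

end SlowFast

/-- The scalar part of `level_le`: `N₁` and `N₂` count slow steps at levels `m₁` and `m₁ + 1`, `f₂`
and `f₃` are vertical detours, `Q = p ^ (m₁ + 1)` and `P = p ^ m₂`. As `N₁` is roughly at least `p *
N₂`, `h₁` bounds `N₂`, and then `f₃`, `f₂` and `P` in turn. -/
theorem level_arith {a b p Q P N₁ N₂ f₂ f₃ : ℝ} (ha : 0 < a) (hab : a < b) (hp : 3 ≤ p)
    (hQ : 3 ≤ Q) (h₁ : (b - a) * N₁ ≤ (b - a) * N₂ + b * Q) (hN : p * N₂ ≤ N₁ + 1 + p)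
    (h₃ : a * f₃ ≤ (b - a) * N₂ + b * Q) (h₂ : a * f₂ ≤ b * f₃) (h0 : 0 ≤ f₃)
    (hP : 2 * P ≤ f₂ + f₃) : 2 * a ^ 2 * P ≤ 5 * b ^ 2 * Q := by
  obtain ⟨c, hc, rfl⟩ : ∃ c, 0 < c ∧ b = a + c := ⟨b - a, by linarith, by ring⟩
  rw [add_sub_cancel_left] at h₁ h₃
  have hb : 0 < a + c := by linarith
  have hbQ : 3 * (a + c) ≤ (a + c) * Q := by
    have := mul_le_mul_of_nonneg_left hQ hb.le
    linarith
  have k2 : 2 * (c * N₂) ≤ c * 4 + (a + c) * Q := by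
    have e1 := mul_le_mul_of_nonneg_left hN hc.le
    have e2 : (2 * (c * N₂)) * (p - 1) ≤ (c * 4 + (a + c) * Q) * (p - 1) := by
      have e3 : 0 ≤ (2 * c + (a + c) * Q) * (p - 3) := mul_nonneg (by linarith) (by linarith)
      linarith
    exact le_of_mul_le_mul_right e2 (by linarith)
  have k3 : a * f₃ ≤ 13 / 6 * ((a + c) * Q) := by linarith
  have k4 := mul_le_mul_of_nonneg_left hP ha.le
  have k5 : a * f₃ ≤ (a + c) * f₃ := mul_le_mul_of_nonneg_right (by linarith) h0
  have k6 : a * (2 * P) ≤ 2 * ((a + c) * f₃) := by linarith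
  have k7 := mul_le_mul_of_nonneg_left k6 ha.le
  have k8 := mul_le_mul_of_nonneg_left k3 hb.le
  have k9 : 0 ≤ (a + c) * ((a + c) * Q) := mul_nonneg hb.le (by linarith)
  linarith

namespace SlowFast

variable (S : SlowFast)

/-- Splitting at `e` makes the vertical term count the whole detour through `e`. -/
theorem le_dist_of_hStripped {m : ℕ} {u v e : ℤ × ℤ} (γ : squareLattice.Walk u v)
    (hγ : S.graph.IsGeodesic γ) (hs : S.HStripped (m + 1) γ) (he : e ∈ γ.support) :
    |S.φ m u.1 - S.φ m v.1| + S.a * (|(u.2 : ℝ) - e.2| + |(e.2 : ℝ) - v.2|) ≤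
      S.graph.dist u v := by
  obtain ⟨Y, hY, hs⟩ := hs
  obtain ⟨γ₁, γ₂, rfl, hcost⟩ := S.graph.cost_split γ he
  have key : ∀ {x y : ℤ × ℤ} (δ : squareLattice.Walk x y),
      (∀ z ∈ δ.support, InStrip ((S.p : ℤ) ^ (m + 1)) Y z) →
      |S.φ m x.1 - S.φ m y.1| + S.a * |(x.2 : ℝ) - y.2| ≤ S.graph.cost δ := fun δ hδ =>
    S.graph.le_cost_of_forall_mem (InStrip ((S.p : ℤ) ^ (m + 1)) Y)
      (fun x t => |S.φ m x.1 - S.φ m t.1| + S.a * |(x.2 : ℝ) - t.2|) (fun t => by simp)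
      (fun x y h hx t => S.strip_lipschitz m h (not_dvd_of_lt_of_lt hY hx.1 hx.2) t) δ hδ
  have h1 := key γ₁ fun z hz => hs z (by
    rw [SimpleGraph.Walk.mem_support_append_iff]
    exact .inl hz)
  have h2 := key γ₂ fun z hz => hs z (by
    rw [SimpleGraph.Walk.mem_support_append_iff]
    exact .inr hz)
  have h3 := abs_sub_le (S.φ m u.1) (S.φ m e.1) (S.φ m v.1)
  have h4 : S.graph.cost (γ₁.append γ₂) = S.graph.dist u v := hγ
  linarith

theorem dist_le_via_line {n : ℕ} {Y : ℤ} (hY : (S.p : ℤ) ^ n ∣ Y) (u v : ℤ × ℤ) :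
    S.graph.dist u v ≤ |S.φ n u.1 - S.φ n v.1| +
      S.b * (|(u.2 : ℝ) - Y| + |(Y : ℝ) - v.2|) := by
  have h1 := S.dist_le u (u.1, Y)
  have h2 := S.dist_le (v.1, Y) v
  have h3 := S.dist_horizontal_le hY u.1 v.1
  have h4 := S.dist_triangle u (u.1, Y) v
  have h5 := S.dist_triangle (u.1, Y) (v.1, Y) v
  simp only [sub_self, abs_zero, zero_add] at h1 h2
  linarith

/-- All levels occurring in a slice, but the highest one, are bounded in terms of any of them. -/
theorem level_le {m₁ m₂ m₃ : ℕ} (h23 : m₂ < m₃) {u v : ℤ × ℤ} {r : ℝ}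
    (h₁ : (S.stripSlice m₁ u v r).Nonempty) (h₂ : (S.stripSlice m₂ u v r).Nonempty)
    (h₃ : (S.stripSlice m₃ u v r).Nonempty) :
    2 * (S.a : ℝ) ^ 2 * (S.p : ℝ) ^ m₂ ≤ 5 * (S.b : ℝ) ^ 2 * (S.p : ℝ) ^ (m₁ + 1) := by
  obtain ⟨-, -, -, γ₁, hγ₁, -, hs₁, e₁, he₁, -⟩ := h₁
  obtain ⟨-, -, -, γ₂, hγ₂, -, hs₂, e₂, he₂, -, hd₂⟩ := h₂
  obtain ⟨-, -, -, γ₃, hγ₃, -, hs₃, e₃, he₃, -, hd₃⟩ := h₃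
  have ha := S.a_pos'
  have hab := S.lt'
  have hp3 : (3 : ℝ) ≤ S.p := by exact_mod_cast S.three_le
  have l₁ := S.le_dist_of_hStripped γ₁ hγ₁ hs₁ he₁
  have l₂ := S.le_dist_of_hStripped γ₂ hγ₂ hs₂ he₂
  have l₃ := S.le_dist_of_hStripped γ₃ hγ₃ hs₃ he₃
  have u₃ := S.dist_le_via_line hd₃ u v
  have hφ := S.abs_φ_mono h23.le u.1 v.1
  have hf₁ : (0 : ℝ) ≤ |(u.2 : ℝ) - e₁.2| + |(e₁.2 : ℝ) - v.2| := by positivity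
  -- The detours to the two boundary lines of the strip have total length `2 * p ^ (m₁ + 1)`;
  -- averaging the two routes gives the bound.
  have u₁ : S.graph.dist u v ≤ |S.φ (m₁ + 1) u.1 - S.φ (m₁ + 1) v.1| +
      S.b * (S.p : ℝ) ^ (m₁ + 1) := by
    obtain ⟨Y, hY, hs⟩ := hs₁
    have hu := hs u (by simp)
    have hv := hs v (by simp)
    have g1 := S.dist_le_via_line hY u v
    have g2 := S.dist_le_via_line (dvd_add hY dvd_rfl) u v
    have a1 : (Y : ℝ) < u.2 := by exact_mod_cast hu.1
    have a2 : (u.2 : ℝ) < Y + (S.p : ℝ) ^ (m₁ + 1) := by exact_mod_cast hu.2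
    have a3 : (Y : ℝ) < v.2 := by exact_mod_cast hv.1
    have a4 : (v.2 : ℝ) < Y + (S.p : ℝ) ^ (m₁ + 1) := by exact_mod_cast hv.2
    rw [abs_of_pos (sub_pos.2 a1), abs_of_neg (sub_neg.2 a3)] at g1
    push_cast at g2
    rw [abs_of_neg (sub_neg.2 a2), abs_of_pos (sub_pos.2 a4)] at g2
    linarith
  set D := S.graph.dist u v
  set f₂ := |(u.2 : ℝ) - e₂.2| + |(e₂.2 : ℝ) - v.2| with hf₂
  set f₃ := |(u.2 : ℝ) - e₃.2| + |(e₃.2 : ℝ) - v.2| with hf₃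
  -- The heights of `e₂` and `e₃` are multiples of `p ^ m₂`. They differ, since `e₃` is on a row of
  -- level `m₂ + 1` and `e₂` is inside a strip between such rows.
  have hff : 2 * (S.p : ℝ) ^ m₂ ≤ f₂ + f₃ := by
    have h1 : (S.p : ℤ) ^ m₂ ≤ |e₂.2 - e₃.2| := by
      refine Int.le_of_dvd ?_ ((dvd_abs _ _).2 (dvd_sub hd₂ ((pow_dvd_pow _ h23.le).trans hd₃)))
      rw [abs_pos, sub_ne_zero]
      intro h
      obtain ⟨Y, hY, hs⟩ := hs₂
      have := hs e₂ he₂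
      apply not_dvd_of_lt_of_lt hY this.1 this.2
      rw [h]
      exact (pow_dvd_pow _ h23).trans hd₃
    have h2 : (S.p : ℝ) ^ m₂ ≤ |(e₂.2 : ℝ) - e₃.2| := by exact_mod_cast h1
    have h3 := abs_sub_le (e₂.2 : ℝ) u.2 e₃.2
    have h4 := abs_sub_le (e₂.2 : ℝ) v.2 e₃.2
    rw [abs_sub_comm (e₂.2 : ℝ) u.2] at h3
    rw [abs_sub_comm (v.2 : ℝ) e₃.2] at h4
    linarith
  have hX : S.a * |(u.1 : ℝ) - v.1| ≤ |S.φ m₃ u.1 - S.φ m₃ v.1| := S.a_mul_le_abs_φ _ _ _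
  have e₁ : |S.φ m₁ u.1 - S.φ m₁ v.1| = _ := abs_pot_eq S.lt S.odd m₁ u.1 v.1
  have e₂ : |S.φ (m₁ + 1) u.1 - S.φ (m₁ + 1) v.1| = _ := abs_pot_eq S.lt S.odd (m₁ + 1) u.1 v.1
  rw [e₁] at l₁
  rw [e₂] at u₁
  have n₁ := (pow_mul_abs_nearestIdx S.p_pos m₁ u.1 v.1).2
  have n₂ := (pow_mul_abs_nearestIdx S.p_pos (m₁ + 1) u.1 v.1).1
  have hQ : (3 : ℝ) ≤ (S.p : ℝ) ^ (m₁ + 1) :=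
    hp3.trans (le_self_pow₀ (by linarith) (Nat.succ_ne_zero _))
  rw [pow_succ] at n₂
  set N₁ := |(nearestIdx S.p m₁ u.1 : ℝ) - nearestIdx S.p m₁ v.1|
  set N₂ := |(nearestIdx S.p (m₁ + 1) u.1 : ℝ) - nearestIdx S.p (m₁ + 1) v.1|
  have hq : (0 : ℝ) < (S.p : ℝ) ^ m₁ := by positivity
  have hN : (S.p : ℝ) * N₂ ≤ N₁ + 1 + S.p := by
    refine le_of_mul_le_mul_left ?_ hq
    linarith
  set Q := (S.p : ℝ) ^ (m₁ + 1)
  have hN0 : 0 ≤ N₂ := abs_nonneg _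
  have hc : 0 < (S.b : ℝ) - S.a := sub_pos.2 hab
  have g1 : (S.b - S.a) * N₁ ≤ (S.b - S.a) * N₂ + S.b * Q := by
    have := mul_nonneg ha.le hf₁
    linarith
  have g3 : S.a * f₃ ≤ (S.b - S.a) * N₂ + S.b * Q := by linarith
  have g4 : S.a * f₂ ≤ S.b * f₃ := by linarith
  exact level_arith ha hab hp3 hQ g1 hN g3 g4 (by positivity) hff

end SlowFast

/-! ### Assembling the explicit bound. -/

namespace SlowFast

variable (S : SlowFast)

/-- The logarithm in the bound for the slices. -/
noncomputable def logTerm : ℝ := Real.logb S.p (18 * S.b * (S.p : ℝ) ^ 2 / S.a)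

theorem three_le' : (3 : ℝ) ≤ S.p := by exact_mod_cast S.three_le

theorem one_lt_ratio : (1 : ℝ) < S.b / S.a := by
  rw [lt_div_iff₀ S.a_pos', one_mul]
  exact S.lt'

theorem natCast_le_two_mul_logTerm {n : ℕ}
    (h : (S.p : ℝ) ^ n ≤ (18 * (S.b / S.a) * (S.p : ℝ) ^ 2) ^ 2) : (n : ℝ) ≤ 2 * S.logTerm := by
  have hp := S.three_le'
  have h1 : Real.logb S.p ((S.p : ℝ) ^ n) ≤
      Real.logb S.p ((18 * (S.b / S.a) * (S.p : ℝ) ^ 2) ^ 2) :=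
    Real.logb_le_logb_of_le (by linarith) (by positivity) h
  rw [Real.logb_pow, Real.logb_pow, Real.logb_self_eq_one (by linarith)] at h1
  unfold logTerm
  rw [show 18 * (S.b : ℝ) * (S.p : ℝ) ^ 2 / S.a = 18 * (S.b / S.a) * (S.p : ℝ) ^ 2 by ring]
  push_cast at h1
  linarith

theorem logTerm_bounds : 2 ≤ S.logTerm ∧ S.logTerm ≤ 4.5 + S.b / S.a := by
  have hp := S.three_le'
  have hβ := S.one_lt_ratio
  have hlogp : 1 ≤ Real.log S.p := by
    rw [Real.le_log_iff_exp_le (by linarith)]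
    have := Real.exp_one_lt_d9
    linarith
  have h1 : S.logTerm = Real.logb S.p (18 * (S.b / S.a)) + 2 := by
    unfold logTerm
    rw [show 18 * (S.b : ℝ) * (S.p : ℝ) ^ 2 / S.a = 18 * (S.b / S.a) * (S.p : ℝ) ^ 2 by ring,
      Real.logb_mul (by positivity) (by positivity), Real.logb_pow,
      Real.logb_self_eq_one (by linarith)]
    push_cast
    ring
  have h2 : 0 ≤ Real.log (18 * (S.b / S.a)) := Real.log_nonneg (by linarith)
  have h3 : Real.log (18 * (S.b / S.a)) ≤ 2.5 + S.b / S.a := by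
    rw [Real.log_mul (by norm_num) (by positivity)]
    have e1 := Real.log_le_sub_one_of_pos (show (0 : ℝ) < S.b / S.a by linarith)
    -- `18 ≤ 2 ^ 5` suffices, since `5 * log 2 < 3.5`.
    have e2 : Real.log 18 ≤ Real.log ((2 : ℝ) ^ 5) :=
      Real.log_le_log (by norm_num) (by norm_num)
    rw [Real.log_pow] at e2
    have e3 := Real.log_two_lt_d9
    push_cast at e2
    linarith
  rw [h1, Real.logb]
  constructor
  · have : 0 ≤ Real.log (18 * (S.b / S.a)) / Real.log S.p := by positivity
    linarith
  · have : Real.log (18 * (S.b / S.a)) / Real.log S.p ≤ Real.log (18 * (S.b / S.a)) :=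
      div_le_self h2 hlogp
    linarith

open Classical in
/-- The levels below `k` that occur in a slice. -/
noncomputable def levels (k : ℕ) (u v : ℤ × ℤ) (r : ℝ) : Finset ℕ :=
  {m ∈ Finset.range k | (S.stripSlice m u v r).Nonempty}

/-- `level_le` is applied to the least, the second greatest and the greatest level. The `2` added to
`m₂ - m₁` counts an endpoint of the interval and the greatest level. -/
theorem card_levels_le (k : ℕ) (u v : ℤ × ℤ) (r : ℝ) :
    ((S.levels k u v r).card : ℝ) ≤ 2 * S.logTerm := by
  have hp := S.three_le'
  have hβ := S.one_lt_ratio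
  have hL := S.logTerm_bounds.1
  set U := S.levels k u v r with hU
  have hmem : ∀ m ∈ U, (S.stripSlice m u v r).Nonempty := fun m hm => by
    classical
    rw [hU, levels, Finset.mem_filter] at hm
    exact hm.2
  rcases le_or_gt U.card 1 with h1 | h1
  · have : (U.card : ℝ) ≤ 1 := by exact_mod_cast h1
    linarith
  have hne : U.Nonempty := Finset.card_pos.1 (by omega)
  set m₃ := U.max' hne
  have hm₃ : m₃ ∈ U := U.max'_mem hne
  have hcard := Finset.card_erase_of_mem hm₃
  have hne' : (U.erase m₃).Nonempty := Finset.card_pos.1 (by omega)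
  set m₁ := (U.erase m₃).min' hne'
  set m₂ := (U.erase m₃).max' hne'
  have hm₁ : m₁ ∈ U.erase m₃ := (U.erase m₃).min'_mem hne'
  have hm₂ : m₂ ∈ U.erase m₃ := (U.erase m₃).max'_mem hne'
  have h12 : m₁ ≤ m₂ := Finset.min'_le _ _ hm₂
  have h23 : m₂ < m₃ := lt_of_le_of_ne (U.le_max' _ (Finset.mem_of_mem_erase hm₂))
    (Finset.ne_of_mem_erase hm₂)
  have hsub : U.erase m₃ ⊆ Finset.Icc m₁ m₂ := fun m hm =>
    Finset.mem_Icc.2 ⟨Finset.min'_le _ _ hm, Finset.le_max' _ _ hm⟩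
  have hc : U.card ≤ m₂ - m₁ + 2 := by
    have := Finset.card_le_card hsub
    rw [Nat.card_Icc] at this
    omega
  have hlev := S.level_le h23 (hmem _ (Finset.mem_of_mem_erase hm₁))
    (hmem _ (Finset.mem_of_mem_erase hm₂)) (hmem _ hm₃)
  have ha := S.a_pos'
  have h2 : (S.p : ℝ) ^ (m₂ - m₁) ≤ 5 / 2 * (S.b / S.a) ^ 2 * S.p := by
    have hq : (0 : ℝ) < (S.p : ℝ) ^ m₁ := by positivity
    refine le_of_mul_le_mul_right ?_ hq
    rw [← pow_add, Nat.sub_add_cancel h12]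
    have e : 5 / 2 * ((S.b : ℝ) / S.a) ^ 2 * S.p * (S.p : ℝ) ^ m₁ =
        5 * (S.b : ℝ) ^ 2 * (S.p : ℝ) ^ (m₁ + 1) / (2 * (S.a : ℝ) ^ 2) := by
      rw [eq_div_iff (by positivity), pow_succ]
      field_simp
      ring
    rw [e, le_div_iff₀ (by positivity)]
    linarith
  have h3 : ((m₂ - m₁ + 2 : ℕ) : ℝ) ≤ 2 * S.logTerm := by
    apply S.natCast_le_two_mul_logTerm
    rw [pow_add]
    calc (S.p : ℝ) ^ (m₂ - m₁) * (S.p : ℝ) ^ 2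
        ≤ 5 / 2 * (S.b / S.a) ^ 2 * S.p * (S.p : ℝ) ^ 2 := by gcongr
      _ ≤ 324 * (S.b / S.a) ^ 2 * (S.p : ℝ) * (S.p : ℝ) ^ 3 := by
        have : (S.p : ℝ) ^ 2 ≤ (S.p : ℝ) ^ 3 := pow_le_pow_right₀ (by linarith) (by norm_num)
        gcongr
        norm_num
      _ = _ := by ring
  have h4 : (U.card : ℝ) ≤ ((m₂ - m₁ + 2 : ℕ) : ℝ) := by exact_mod_cast hc
  linarith

theorem cardLE_iUnion_stripSlice (k : ℕ) (u v : ℤ × ℤ) (r : ℝ) :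
    CardLE {w | ∃ m < k, w ∈ S.stripSlice m u v r}
      (2 * S.logTerm * (8 * (S.p * (2 * ((S.b : ℝ) / S.a * S.p) + 2)))) := by
  have hβ := S.one_lt_ratio
  refine (CardLE.biUnion (S.levels k u v r) (fun m => S.stripSlice m u v r)
    fun m _ => S.cardLE_stripSlice m u v r).mono ?_ ?_
  · rintro w ⟨m, hm, hw⟩
    rw [Set.mem_iUnion₂]
    refine ⟨m, ?_, hw⟩
    classical
    rw [levels, Finset.mem_filter, Finset.mem_range]
    exact ⟨hm, w, hw⟩
  · exact mul_le_mul_of_nonneg_right (S.card_levels_le k u v r) (by positivity)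

/-- With `B = b p / a ≥ 3`, the ball of radius `r / a` meets at most `4 B + 2` columns and rows of
cells, and `4 * (4 B + 2) ^ 2 ≤ 88 * B ^ 2`. -/
theorem cardLE_goodSlice {n : ℕ} {u : ℤ × ℤ} {r : ℝ} (hr0 : 0 ≤ r)
    (hr : r ≤ 2 * S.b * (S.p : ℝ) ^ (n + 1)) :
    CardLE {w | S.graph.dist u w = r ∧ (S.GoodV n u w ∨ S.GoodV n u.swap w.swap)}
      (88 * ((S.b : ℝ) / S.a * S.p) ^ 2) := by
  have ha := S.a_pos'
  have hp := S.three_le'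
  have hβ := S.one_lt_ratio
  have hq := S.pow_pos n
  have hR : 0 ≤ r / S.a := by positivity
  have hwin : ∀ w, S.graph.dist u w = r →
      |(w.1 : ℝ) - u.1| ≤ r / S.a ∧ |(w.2 : ℝ) - u.2| ≤ r / S.a := fun w hw => by
    have h := S.le_dist w u
    rw [S.dist_comm, hw] at h
    have h1 := abs_nonneg ((w.1 : ℝ) - u.1)
    have h2 := abs_nonneg ((w.2 : ℝ) - u.2)
    rw [le_div_iff₀ ha, le_div_iff₀ ha]
    constructor <;> nlinarith
  refine (S.cardLE_good (fun w hw => hw) _ _ (fun w hw => ediv_mem_window hq (hwin w hw.1).1)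
    (fun w hw => ediv_mem_window hq (hwin w hw.1).2)).mono subset_rfl ?_
  have h1 := card_window_le (c := u.1) hq hR
  have h2 := card_window_le (c := u.2) hq hR
  set B := (S.b : ℝ) / S.a * S.p with hB
  have hB3 : 3 ≤ B := by nlinarith
  have h3 : 2 * (r / S.a) / ((S.p ^ n : ℤ) : ℝ) ≤ 4 * B := by
    push_cast
    rw [div_le_iff₀ (by positivity), hB, ← mul_div_assoc, div_le_iff₀ ha]
    rw [pow_succ] at hr
    have : 4 * ((S.b : ℝ) / S.a * S.p) * (S.p : ℝ) ^ n * S.a =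
        2 * (2 * S.b * ((S.p : ℝ) ^ n * S.p)) := by
      field_simp
      ring
    linarith
  have h4 := mul_le_mul (h1.trans (add_le_add_left h3 2)) (h2.trans (add_le_add_left h3 2))
    (by positivity) (by positivity)
  nlinarith

/-- The bound for the slices. -/
noncomputable def sliceBound : ℝ :=
  160 * ((S.b : ℝ) / S.a * S.p) ^ 2 + 64 * S.p * (S.p + 3 * ((S.b : ℝ) / S.a)) * S.logTerm

theorem good_add_strip_le_sliceBound :
    88 * ((S.b : ℝ) / S.a * S.p) ^ 2 +
      2 * S.logTerm * (8 * (S.p * (2 * ((S.b : ℝ) / S.a * S.p) + 2))) ≤ S.sliceBound := by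
  have hp := S.three_le'
  have hβ := S.one_lt_ratio
  obtain ⟨hL, hL'⟩ := S.logTerm_bounds
  unfold sliceBound
  set β := (S.b : ℝ) / S.a
  set L := S.logTerm
  -- Multiplied by `8 p ^ 2`, this splits the term `32 β p ^ 2 L` into the two shapes of the bound;
  -- `88 + 72 = 160`.
  have h1 : 4 * (β * L) ≤ 8 * L + 9 * β ^ 2 := by
    rcases le_or_gt β 2 with h | h
    · nlinarith
    · have := mul_le_mul_of_nonneg_left hL' (show 0 ≤ β - 2 by linarith)
      norm_num at this
      nlinarith [sq_nonneg (β - 1)]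
  have h2 : S.p * L ≤ S.p * (β * L) :=
    mul_le_mul_of_nonneg_left (by nlinarith) (by linarith)
  have h3 := mul_le_mul_of_nonneg_left h1 (show (0 : ℝ) ≤ (S.p : ℝ) ^ 2 by positivity)
  nlinarith

theorem exists_scale {x r : ℝ} (hx : x < r) (hx0 : 0 < x) :
    ∃ k : ℕ, x * (S.p : ℝ) ^ k < r ∧ r ≤ x * (S.p : ℝ) ^ (k + 1) := by
  have hp := S.three_le'
  obtain ⟨n, hn⟩ := pow_unbounded_of_one_lt (r / x) (show (1 : ℝ) < S.p by linarith)
  rw [div_lt_iff₀ hx0] at hn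
  induction n with
  | zero => exact absurd hn (by rw [pow_zero]; linarith)
  | succ n ih =>
    rcases lt_or_ge r ((S.p : ℝ) ^ n * x) with h | h
    · exact ih h
    · rcases h.eq_or_lt with h | h
      · rcases n with _ | n
        · rw [pow_zero] at h
          linarith
        · refine ⟨n, ?_, by linarith⟩
          have : (S.p : ℝ) ^ n < (S.p : ℝ) ^ (n + 1) :=
            pow_lt_pow_right₀ (by linarith) (Nat.lt_succ_self n)
          have := mul_lt_mul_of_pos_right this hx0
          linarith
      · exact ⟨n, by linarith, by linarith⟩

theorem dist_le_of_near {n : ℕ} {u w : ℤ × ℤ} (h : S.Near n u w) :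
    S.graph.dist u w ≤ 2 * S.b * (S.p : ℝ) ^ n := by
  have h1 := S.dist_le u w
  have h2 : |(u.1 : ℝ) - w.1| < (S.p : ℝ) ^ n := by exact_mod_cast h.1
  have h3 : |(u.2 : ℝ) - w.2| < (S.p : ℝ) ^ n := by exact_mod_cast h.2
  have hb : (0 : ℝ) < S.b := S.a_pos'.trans S.lt'
  have h4 := mul_le_mul_of_nonneg_left (add_le_add h2.le h3.le) hb.le
  linarith

theorem good_zero (u w : ℤ × ℤ) : S.GoodV 0 u w :=
  ⟨by simp, .inl fun y hy h => by simp at h; omega⟩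

theorem abs_sub_lt_of_hStripped {n k : ℕ} (hnk : n ≤ k) {u v : ℤ × ℤ}
    {γ : squareLattice.Walk u v} (h : S.HStripped n γ) : |u.2 - v.2| < (S.p : ℤ) ^ k := by
  obtain ⟨Y, -, hs⟩ := h
  have h1 := hs u (by simp)
  have h2 := hs v (by simp)
  have h3 := S.pow_le_pow hnk
  unfold InStrip at h1 h2
  rw [abs_lt]
  omega

/-- Every vertex is good at level `0`. If this fails at level `k`, it is lost between some `m` and
`m + 1`, and `stripped_or_good` at level `m + 1` leaves only a strip. -/
theorem mem_slice_cases {k : ℕ} {u v w : ℤ × ℤ} {r : ℝ} (hr : 2 * S.b * (S.p : ℝ) ^ k < r)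
    (hr2 : 2 * r ≤ S.graph.dist u v) (hw : w ∈ S.graph.slice u v r) :
    (S.graph.dist u w = r ∧ (S.GoodV k u w ∨ S.GoodV k u.swap w.swap)) ∨
      (∃ m < k, w ∈ S.stripSlice m u v r) ∨
        ∃ m < k, w.swap ∈ S.stripSlice m u.swap v.swap r := by
  obtain ⟨⟨γ, hγ, hwγ⟩, hdist⟩ := hw
  have hb : (0 : ℝ) < S.b := S.a_pos'.trans S.lt'
  have hp := S.three_le'
  have hfar : ∀ n ≤ k, ∀ x, r ≤ S.graph.dist x w → ¬ S.Near n x w := fun n hn x hx h => by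
    have h1 := S.dist_le_of_near h
    have h2 : (S.p : ℝ) ^ n ≤ (S.p : ℝ) ^ k := pow_le_pow_right₀ (by linarith) hn
    have h3 := mul_le_mul_of_nonneg_left h2 hb.le
    linarith
  have hvw : r ≤ S.graph.dist v w := by
    have := S.dist_triangle u w v
    rw [S.dist_comm w v] at this
    linarith
  have hstep : ∀ n ≤ k, S.HStripped n γ ∨ S.VStripped n γ ∨
      (S.GoodV n u w ∨ S.GoodV n u.swap w.swap) ∧ S.MeetsGrid n γ := fun n hn =>
    S.stripped_or_good γ hγ hwγ (hfar n hn u hdist.ge) (hfar n hn v hvw)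
  by_cases hk : (S.GoodV k u w ∨ S.GoodV k u.swap w.swap) ∧ S.MeetsGrid k γ
  · exact .inl ⟨hdist, hk.1⟩
  right
  obtain ⟨m, hmk, hgood, hbad⟩ : ∃ m < k,
      ((S.GoodV m u w ∨ S.GoodV m u.swap w.swap) ∧ S.MeetsGrid m γ) ∧
      ¬ ((S.GoodV (m + 1) u w ∨ S.GoodV (m + 1) u.swap w.swap) ∧ S.MeetsGrid (m + 1) γ) := by
    clear hstep hfar hr
    induction k with
    | zero => exact absurd ⟨.inl (S.good_zero u w), u, by simp, by simp, by simp⟩ hk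
    | succ k ih =>
      by_cases h : (S.GoodV k u w ∨ S.GoodV k u.swap w.swap) ∧ S.MeetsGrid k γ
      · exact ⟨k, Nat.lt_succ_self k, h, hk⟩
      · obtain ⟨m, hm, h⟩ := ih h
        exact ⟨m, hm.trans (Nat.lt_succ_self k), h⟩
  rcases hstep (m + 1) hmk with h | h | h
  · exact .inl ⟨m, hmk, hdist, hgood.1, γ, hγ, hwγ, h, hgood.2⟩
  · refine .inr ⟨m, hmk, (S.dist_swap u w).trans hdist, hgood.1.symm, γ.map squareLatticeSwap,
      ?_, ?_, S.hStripped_map_swap.2 h, ?_⟩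
    · exact (S.cost_swap γ).trans (hγ.trans (S.dist_swap u v).symm)
    · exact (SimpleGraph.Walk.support_map squareLatticeSwap γ) ▸ List.mem_map_of_mem hwγ
    · obtain ⟨e, he, he1, he2⟩ := hgood.2
      refine ⟨e.swap, ?_, he2, he1⟩
      exact (SimpleGraph.Walk.support_map squareLatticeSwap γ) ▸ List.mem_map_of_mem he
  · exact absurd h hbad

theorem cardLE_slice_of_two_mul_le {u v : ℤ × ℤ} {r : ℝ} (hr2 : 2 * r ≤ S.graph.dist u v) :
    CardLE (S.graph.slice u v r) S.sliceBound := by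
  have ha := S.a_pos'
  have hb : (0 : ℝ) < S.b := ha.trans S.lt'
  have hp := S.three_le'
  have hL := S.logTerm_bounds.1
  have hbound := S.good_add_strip_le_sliceBound
  have hstrip0 : 0 ≤ 2 * S.logTerm * (8 * (S.p * (2 * ((S.b : ℝ) / S.a * S.p) + 2))) := by
    positivity
  have hgood0 : 0 ≤ 88 * ((S.b : ℝ) / S.a * S.p) ^ 2 := by positivity
  rcases (S.graph.slice u v r).eq_empty_or_nonempty with h0 | ⟨w₀, hw₀⟩
  · rw [h0]
    exact CardLE.empty (by linarith)
  have hr0 : 0 ≤ r := by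
    rw [← hw₀.2]
    exact le_trans (by positivity) (S.le_dist u w₀)
  rcases le_or_gt r (2 * S.b) with hr | hr
  · have h1 : r ≤ 2 * S.b * (S.p : ℝ) ^ (0 + 1) := by
      rw [zero_add, pow_one]
      nlinarith
    exact (S.cardLE_goodSlice (u := u) hr0 h1).mono
      (fun w hw => ⟨hw.2, .inl (S.good_zero u w)⟩) (by linarith)
  obtain ⟨k, hk1, hk2⟩ := S.exists_scale hr (by linarith)
  have hgood := S.cardLE_goodSlice (u := u) hr0 hk2
  by_cases hH : ∃ w, ∃ m < k, w ∈ S.stripSlice m u v r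
  · refine (hgood.union (S.cardLE_iUnion_stripSlice k u v r)).mono (fun w hw => ?_) hbound
    rcases S.mem_slice_cases hk1 hr2 hw with h | h | h
    · exact .inl h
    · exact .inr h
    · exfalso
      obtain ⟨w', m', hm', -, -, γ', -, -, h', -⟩ := hH
      obtain ⟨m, hm, -, -, γ, -, -, h, -⟩ := h
      -- Confinement in both directions would make `u` and `v` near at level `k`, whereas `dist u v
      -- ≥ 2 * r`. So only one family of strips contributes.
      have h1 := S.abs_sub_lt_of_hStripped hm h
      have h2 := S.abs_sub_lt_of_hStripped hm' h'
      have h3 := S.dist_le_of_near (n := k) ⟨h1, h2⟩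
      linarith
  · refine (hgood.union (CardLE.of_image Prod.swap_injective
      ((S.cardLE_iUnion_stripSlice k u.swap v.swap r).mono (Set.image_preimage_subset _ _)
        le_rfl))).mono (fun w hw => ?_) hbound
    rcases S.mem_slice_cases hk1 hr2 hw with h | h | h
    · exact .inl h
    · exact absurd ⟨w, h⟩ hH
    · exact .inr h

/-- Exchanging the ends reduces to slices in the nearer half, where `w` is at distance at least `r`
from `v` too. -/
theorem slice_subset_slice_reverse (u v : ℤ × ℤ) (r : ℝ) :
    S.graph.slice u v r ⊆ S.graph.slice v u (S.graph.dist u v - r) := by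
  rintro w ⟨⟨γ, hγ, hw⟩, hr⟩
  refine ⟨⟨γ.reverse, ?_, by simpa using hw⟩, ?_⟩
  · rw [WeightedGraph.IsGeodesic, WeightedGraph.cost_reverse, S.dist_comm]
    exact hγ
  · obtain ⟨p, q, -, hc⟩ := S.graph.cost_split γ hw
    have h1 := S.graph.dist_le_cost p
    have h2 := S.graph.dist_le_cost q
    have h3 := S.dist_triangle u w v
    have h4 : S.graph.cost γ = S.graph.dist u v := hγ
    rw [S.dist_comm v w]
    linarith

theorem cardLE_slice (u v : ℤ × ℤ) (r : ℝ) : CardLE (S.graph.slice u v r) S.sliceBound := by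
  rcases le_total (2 * r) (S.graph.dist u v) with h | h
  · exact S.cardLE_slice_of_two_mul_le h
  · refine CardLE.mono (S.cardLE_slice_of_two_mul_le ?_) (S.slice_subset_slice_reverse u v r) le_rfl
    rw [S.dist_comm v u]
    linarith

end SlowFast

theorem slowFastGraph_slicesBoundedBy (p a b : ℕ) (hp : Odd p) (h3 : 3 ≤ p) (ha : 0 < a)
    (hab : a < b) :
    (slowFastGraph p a b ha (ha.trans hab)).SlicesBoundedBy
      (160 * ((b : ℝ) ^ 2 * (p : ℝ) ^ 2 / (a : ℝ) ^ 2) +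
        64 * (p : ℝ) * ((p : ℝ) + 3 * (b : ℝ) / (a : ℝ)) *
          Real.logb (p : ℝ) (18 * (b : ℝ) * (p : ℝ) ^ 2 / (a : ℝ))) := by
  intro u v r _
  have h := SlowFast.cardLE_slice ⟨p, a, b, hp, h3, ha, hab⟩ u v r
  refine h.mono subset_rfl (le_of_eq ?_)
  simp only [SlowFast.sliceBound, SlowFast.logTerm]
  ring

/-- There is a weighted graph on the square lattice with finitely many positive integer weights and
bounded geodesic slices; moreover every `H_{a,b}` has slices bounded by an explicit constant. -/
theorem proposition4 :
    (∃ H : WeightedGraph squareLattice,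
      (Set.range H.weight).Finite ∧
      (∀ e, ∃ m : ℕ, 0 < m ∧ H.weight e = (m : ℝ)) ∧
      H.HasBoundedSlices) ∧
    (∀ (p a b : ℕ), Odd p → 3 ≤ p → ∀ (ha : 0 < a) (hab : a < b),
      (slowFastGraph p a b ha (ha.trans hab)).SlicesBoundedBy
        (160 * ((b : ℝ) ^ 2 * (p : ℝ) ^ 2 / (a : ℝ) ^ 2) +
          64 * (p : ℝ) * ((p : ℝ) + 3 * (b : ℝ) / (a : ℝ)) *
            Real.logb (p : ℝ) (18 * (b : ℝ) * (p : ℝ) ^ 2 / (a : ℝ)))) := by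
  refine ⟨⟨slowFastGraph 3 1 2 one_pos (one_pos.trans one_lt_two), ?_, ?_, _,
    slowFastGraph_slicesBoundedBy 3 1 2 (by decide) le_rfl one_pos one_lt_two⟩,
    slowFastGraph_slicesBoundedBy⟩
  · refine (Set.toFinite {((2 : ℕ) : ℝ), ((1 : ℕ) : ℝ)}).subset ?_
    rintro _ ⟨e, rfl⟩
    simp only [slowFastGraph]
    split_ifs <;> simp
  · intro e
    simp only [slowFastGraph]
    split_ifs
    · exact ⟨2, two_pos, rfl⟩
    · exact ⟨1, one_pos, rfl⟩
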